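/- Let $n,p\ge 1$ be integers and $\sigma,\Delta>0$. For $\theta\in\mathbf R^p$ and $\eta\in\{-1,1\}^n$ let $\mathbf P_{(\theta,\eta)}$ (expectation $\mathbf E_{(\theta,\eta)}$) be the distribution of the $p\times n$ matrix $Y$ with columns $Y_i=\eta_i\theta+\sigma\xi_i$, $i=1,\dots,n$, where $\xi_1,\dots,\xi_n$ are independent standard Gaussian vectors in $\mathbf R^p$. Let $\Omega_\Delta=\{\theta\in\mathbf R^p:\|\theta\|\ge\Delta\}\times\{-1,1\}^n$, let $r(\hat\eta,\eta)=\min_{\nu\in\{-1,1\}}\sum_{j=1}^n|\hat\eta_j-\nu\eta_j|$, and put $$\mathbf r_n=\frac{\Delta^2/\sigma^2}{\sqrt{\Delta^2/\sigma^2+p/n}},\qquad \Phi^{\mathsf c}(t)=\mathbf P(z>t),\quad z\sim\mathcal N(0,1).$$ For a square matrix $M$ let $\mathbf H(M)=M-\mathrm{diag}(M)$, where $\mathrm{diag}(M)$ is the diagonal matrix with the same diagonal as $M$, and let $\mathrm{sign}$ act entrywise with values in $\{-1,1\}$ and $\mathrm{sign}(0)=1$. A spectral estimator is a measurable function $\eta^0=\eta^0(Y)$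 such that $\eta^0=\mathrm{sign}(\hat v)$ for an eigenvector $\hat v$ of $\mathbf H(Y^\top Y)$ associated with its largest eigenvalue; set $\eta^{k+1}=\mathrm{sign}\big(\mathbf H(Y^\top Y)\,\eta^k\big)$ for $k\ge 0$. Theorem. There exist absolute constants $C,C'>0$ and a sequence $(\epsilon_n)$ of real numbers with $\epsilon_n\to0$ as $n\to\infty$ such that, for all integers $n,p\ge1$ and all $\sigma,\Delta>0$ with $\mathbf r_n>C$, and for every spectral estimator $\eta^0$, after $k=\lfloor 3\log n\rfloor$ steps, $$\sup_{(\theta,\eta)\in\Omega_\Delta}\frac1n\,\mathbf E_{(\theta,\eta)}\,r(\eta^k,\eta)\;\le\; C'\,\Phi^{\mathsf c}\!\left(\mathbf r_n\Big(1-\epsilon_n-\frac{C'\log\mathbf r_n}{\mathbf r_n}\Big)\right).$$ -/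

import Mathlib

open MeasureTheory ProbabilityTheory Filter Topology
open scoped ENNReal

namespace GaussMix

/-- Matrices carry the product sigma-algebra of their entries. -/
instance matrixMeasurableSpace {n p : ℕ} : MeasurableSpace (Matrix (Fin p) (Fin n) ℝ) :=
  inferInstanceAs (MeasurableSpace (Fin p → Fin n → ℝ))

/-- `η ∈ {-1, 1}ⁿ`, labels being regarded as real vectors. -/
def IsLabel {n : ℕ} (η : Fin n → ℝ) : Prop :=
  ∀ i, η i = 1 ∨ η i = -1

/-- Entrywise sign with values in `{-1, 1}`, with the convention `sign 0 = 1`. -/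
noncomputable def signVec {n : ℕ} (v : Fin n → ℝ) : Fin n → ℝ :=
  fun i => if 0 ≤ v i then 1 else -1

/-- The observation matrix `Y = θ ηᵀ + σ ξ`; its `i`-th column is `Y_i = η_i θ + σ ξ_i`. -/
noncomputable def observation {n p : ℕ} (σ : ℝ) (θ : EuclideanSpace ℝ (Fin p))
    (η : Fin n → ℝ) (ξ : Fin n → Fin p → ℝ) : Matrix (Fin p) (Fin n) ℝ :=
  Matrix.of fun a i => θ a * η i + σ * ξ i a

/-- The distribution `P_(θ,η)` of the observation matrix, where `ξ_1, …, ξ_n` are independent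
standard Gaussian vectors in `ℝᵖ`. -/
noncomputable def law {n p : ℕ} (σ : ℝ) (θ : EuclideanSpace ℝ (Fin p)) (η : Fin n → ℝ) :
    Measure (Matrix (Fin p) (Fin n) ℝ) :=
  (Measure.pi fun _ : Fin n => Measure.pi fun _ : Fin p => gaussianReal 0 1).map
    (observation σ θ η)

/-- `H(M) = M - diag(M)`. -/
def hollow {n : ℕ} (M : Matrix (Fin n) (Fin n) ℝ) : Matrix (Fin n) (Fin n) ℝ :=
  M - Matrix.diagonal M.diag

/-- The hollowed Gram matrix `H(Yᵀ Y)`. -/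
def hollowGram {n p : ℕ} (Y : Matrix (Fin p) (Fin n) ℝ) : Matrix (Fin n) (Fin n) ℝ :=
  hollow (Y.transpose * Y)

/-- `v` is an eigenvector of `M` for the largest eigenvalue of `M`. -/
def IsTopEigenvector {n : ℕ} (M : Matrix (Fin n) (Fin n) ℝ) (v : Fin n → ℝ) : Prop :=
  ∃ l : ℝ, Module.End.HasEigenvector (Matrix.toLin' M) l v ∧
    ∀ m : ℝ, Module.End.HasEigenvalue (Matrix.toLin' M) m → m ≤ l

/-- `η₀` is a spectral estimator: a measurable function of the data with `η₀(Y) = sign(v̂)`, where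
`v̂` is an eigenvector for the top eigenvalue of `H(Yᵀ Y)` (its choice being arbitrary). -/
def IsSpectralEstimator {n p : ℕ} (η₀ : Matrix (Fin p) (Fin n) ℝ → Fin n → ℝ) : Prop :=
  Measurable η₀ ∧ ∀ Y, ∃ v, IsTopEigenvector (hollowGram Y) v ∧ η₀ Y = signVec v

/-- The iterates `η^0 = η₀(Y)`, `η^(k+1) = sign(H(Yᵀ Y) η^k)`. -/
noncomputable def lloyd {n p : ℕ} (η₀ : Matrix (Fin p) (Fin n) ℝ → Fin n → ℝ) :
    ℕ → Matrix (Fin p) (Fin n) ℝ → Fin n → ℝ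
  | 0, Y => η₀ Y
  | k + 1, Y => signVec ((hollowGram Y).mulVec (lloyd η₀ k Y))

/-- `|η' - η| = ∑ⱼ |η'ⱼ - ηⱼ|`, twice the number of disagreements for label vectors. -/
def hamming {n : ℕ} (η' η : Fin n → ℝ) : ℝ :=
  ∑ j, |η' j - η j|

/-- `r(η', η)`, the minimum over `ν ∈ {-1, 1}` of `|η' - ν η|`. -/
def loss {n : ℕ} (η' η : Fin n → ℝ) : ℝ :=
  min (hamming η' η) (hamming η' (-η))

/-- The supremum over `‖θ‖ ≥ Δ` and `η ∈ {-1, 1}ⁿ` of `E_(θ,η) r(est(Y), η)`. -/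
noncomputable def worstCaseRisk {n p : ℕ} (σ Δ : ℝ)
    (est : Matrix (Fin p) (Fin n) ℝ → Fin n → ℝ) : ℝ≥0∞ :=
  ⨆ (θ : EuclideanSpace ℝ (Fin p)) (_ : Δ ≤ ‖θ‖) (η : Fin n → ℝ) (_ : IsLabel η),
    ∫⁻ Y, ENNReal.ofReal (loss (est Y) η) ∂(law σ θ η)

/-- The signal-to-noise ratio `r_n = (Δ²/σ²) / √(Δ²/σ² + p/n)`. -/
noncomputable def snr (n p : ℕ) (σ Δ : ℝ) : ℝ :=
  (Δ ^ 2 / σ ^ 2) / Real.sqrt (Δ ^ 2 / σ ^ 2 + (p : ℝ) / n)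

/-- `Φᶜ(t) = P(z > t)` for a standard Gaussian `z`. -/
noncomputable def gaussTail (t : ℝ) : ℝ :=
  (gaussianReal 0 1).real (Set.Ioi t)

end GaussMix

/-!
# Exponential upper bound for the iterated sign estimator in the two-component Gaussian mixture

By scaling, take `σ = 1`, and let `s = ‖θ‖` and `r² = s⁴ / (s² + p/n)`. Write
`H(Yᵀ Y) = s² η ηᵀ + E`, where `E` is the noise. Two random quantities govern the estimator.

* The operator norm of `E`. The quadratic form of `Yᵀ Y - s² η ηᵀ - p I` at a fixed vector is a
  centred noncentral chi-square variable with an explicit exponential moment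
  (`lintegral_exp_noiseForm_le`). Averaging this moment over a ball replaces the usual net argument
  (`measure_noiseForm_gt_le`), and `|xᵀ E x| ≤ τ n s² ‖x‖²` for all `x` fails with probability at
  most `exp (3 n - c τ² n r²)`.
* The margins `ηᵢ (H(Yᵀ Y) η)ᵢ`. Each of them is a bilinear function of two independent Gaussian
  vectors; Chernoff's bound with the exponent `λ = s² / (s² + p/n) / n`, for which the exponential
  moment is an explicit Gaussian integral, gives that the margin is below `δ n s²` with probability at most
  `exp (-r²/2 + 3 r²/n + δ r²)` (`measure_margin_le`).

On the event where the noise is small everything is deterministic (`loss_iterate_le`): the top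
eigenvector has Rayleigh quotient at least that of `η`, hence it correlates with `±η` and has at
most `2 τ n` wrong signs; one step of the iteration maps `m` mistakes to at most `N + m/16`, where
`N` is the number of margins below `16 τ n s²`; and `3 log n` steps make the remainder less than
one, so that an integer number of mistakes is at most `2 N`. If `N` exceeds `2 τ n`, the trivial
bound `n` on the loss is used, which costs a factor `1/τ`.

With `ρ` the signal-to-noise ratio of the class and `τ = 500 / ρ + n^(-1/4)`, the first event has
failure probability below `exp (-ρ²/2)` for every `ρ`, however large compared to `n`, and the
threshold `16 τ` costs only terms of order `ρ` and `n^(-1/4) ρ²` in the exponent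
(`risk_exponents_le`). These and the factor `1/τ` are absorbed by the corrections `C' log ρ` and
`ε_n = 1000 n^(-1/4)` in the argument of the Gaussian tail.
-/

namespace GaussMix

/-! ### Gaussian integrals -/

/-- The normalizing factor of a tilted Gaussian, in a form in which `x + 2 x²` can be summed over the
coordinates; the first-order term is sharp. -/
theorem inv_sqrt_one_sub_le {x : ℝ} (hx : |x| ≤ 1 / 4) :
    (Real.sqrt (1 - 2 * x))⁻¹ ≤ Real.exp (x + 2 * x ^ 2) := by
  obtain ⟨h1, h2⟩ := abs_le.1 hx
  have hpos : 0 < 1 - 2 * x := by linarith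
  have key : 1 ≤ (1 - 2 * x) * Real.exp (2 * x + 4 * x ^ 2) := by
    rcases le_total 0 x with h0 | h0
    · have h3 := Real.quadratic_le_exp_of_nonneg (x := 2 * x + 4 * x ^ 2) (by positivity)
      have h4 : 1 ≤ (1 - 2 * x) *
          (1 + (2 * x + 4 * x ^ 2) + (2 * x + 4 * x ^ 2) ^ 2 / 2) := by
        have : 0 ≤ x ^ 2 * (2 - 4 * x - 8 * x ^ 2 - 16 * x ^ 3) := by
          apply mul_nonneg (by positivity)
          have : x ^ 2 ≤ (1 / 4) ^ 2 := by gcongr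
          have : x ^ 3 ≤ (1 / 4) ^ 3 := by gcongr
          linarith
        linarith
      exact h4.trans (mul_le_mul_of_nonneg_left h3 hpos.le)
    · have h3 := Real.add_one_le_exp (2 * x + 4 * x ^ 2)
      have h4 : 1 ≤ (1 - 2 * x) * (2 * x + 4 * x ^ 2 + 1) := by
        have : 0 ≤ (-x) ^ 3 := by apply pow_nonneg; linarith
        nlinarith
      exact h4.trans (mul_le_mul_of_nonneg_left h3 hpos.le)
  have h5 : (Real.exp (x + 2 * x ^ 2))⁻¹ ≤ Real.sqrt (1 - 2 * x) := by
    apply Real.le_sqrt_of_sq_le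
    rw [← Real.exp_neg, ← Real.exp_nat_mul]
    have : ((2 : ℕ) : ℝ) * -(x + 2 * x ^ 2) = -(2 * x + 4 * x ^ 2) := by push_cast; ring
    rw [this, Real.exp_neg]
    exact (inv_le_iff_one_le_mul₀ (Real.exp_pos _)).2 key
  exact inv_le_of_inv_le₀ (Real.exp_pos _) h5

/-- The tilted Gaussian density is a multiple of the density of mean `b / (1 - 2x)` and variance
`1 / (1 - 2x)`. -/
theorem lintegral_exp_quadratic_gaussianReal {x b : ℝ} (hx : x < 1 / 2) :
    ∫⁻ z, ENNReal.ofReal (Real.exp (x * z ^ 2 + b * z)) ∂(gaussianReal 0 1) =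
      ENNReal.ofReal ((Real.sqrt (1 - 2 * x))⁻¹ * Real.exp (b ^ 2 / (2 * (1 - 2 * x)))) := by
  have hpos : 0 < 1 - 2 * x := by linarith
  set v : NNReal := ⟨(1 - 2 * x)⁻¹, by positivity⟩ with hv
  have hvv : (v : ℝ) = (1 - 2 * x)⁻¹ := rfl
  have hv0 : v ≠ 0 := by
    intro h
    have : (v : ℝ) = 0 := by simp [h]
    rw [hvv] at this
    exact (inv_pos.2 hpos).ne' this
  rw [gaussianReal_of_var_ne_zero 0 one_ne_zero,
    lintegral_withDensity_eq_lintegral_mul _ (measurable_gaussianPDF 0 1) (by fun_prop)]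
  have : ∀ z, (gaussianPDF 0 1 * fun z => ENNReal.ofReal (Real.exp (x * z ^ 2 + b * z))) z =
      ENNReal.ofReal ((Real.sqrt (1 - 2 * x))⁻¹ * Real.exp (b ^ 2 / (2 * (1 - 2 * x)))) *
        ENNReal.ofReal (gaussianPDFReal (b / (1 - 2 * x)) v z) := by
    intro z
    rw [Pi.mul_apply, gaussianPDF, ← ENNReal.ofReal_mul (gaussianPDFReal_nonneg _ _ _),
      ← ENNReal.ofReal_mul (by positivity)]
    congr 1
    simp only [gaussianPDFReal, hvv, NNReal.coe_one]
    have hs : Real.sqrt (2 * Real.pi * (1 - 2 * x)⁻¹) =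
        Real.sqrt (2 * Real.pi * 1) * (Real.sqrt (1 - 2 * x))⁻¹ := by
      rw [Real.sqrt_mul (by positivity), Real.sqrt_inv, mul_one]
    rw [hs, mul_inv, inv_inv]
    have hne : Real.sqrt (1 - 2 * x) ≠ 0 := (Real.sqrt_pos.2 hpos).ne'
    have e1 : ∀ a d e1 e2 e3 e4 : ℝ, d ≠ 0 → e1 * e2 = e3 * e4 →
        a * e1 * e2 = d⁻¹ * e3 * (a * d * e4) := by
      intro a d e1 e2 e3 e4 hd h
      field_simp
      linear_combination a * h
    apply e1 _ _ _ _ _ _ hne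
    rw [← Real.exp_add, ← Real.exp_add]
    congr 1
    field_simp
    ring
  simp_rw [this]
  rw [lintegral_const_mul _ (by fun_prop), lintegral_gaussianPDFReal_eq_one _ hv0, mul_one]

theorem lintegral_exp_quadratic_le {x b : ℝ} (hx : |x| ≤ 1 / 4) :
    ∫⁻ z, ENNReal.ofReal (Real.exp (x * z ^ 2 + b * z)) ∂(gaussianReal 0 1) ≤
      ENNReal.ofReal (Real.exp (x + 2 * x ^ 2 + b ^ 2 / (2 * (1 - 2 * x)))) := by
  rw [lintegral_exp_quadratic_gaussianReal (by linarith [(abs_le.1 hx).2]), Real.exp_add]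
  exact ENNReal.ofReal_le_ofReal
    (mul_le_mul_of_nonneg_right (inv_sqrt_one_sub_le hx) (Real.exp_pos _).le)

theorem lintegral_pi_prod {ι : Type*} [Fintype ι] {E : ι → Type*}
    [∀ i, MeasurableSpace (E i)] (μ : ∀ i, Measure (E i)) [∀ i, IsProbabilityMeasure (μ i)]
    (f : ∀ i, E i → ℝ≥0∞) (hf : ∀ i, Measurable (f i)) :
    ∫⁻ x, ∏ i, f i (x i) ∂(Measure.pi μ) = ∏ i, ∫⁻ x, f i x ∂(μ i) := by
  have h := lintegral_prod_eq_prod_lintegral_of_indepFun (μ := Measure.pi μ) Finset.univ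
    (fun i x => f i (x i)) (iIndepFun_pi fun i => (hf i).aemeasurable)
    (fun i => (hf i).comp (measurable_pi_apply i))
  rw [h]
  refine Finset.prod_congr rfl fun i _ => ?_
  exact (measurePreserving_eval μ i).lintegral_comp (hf i)

theorem lintegral_pi_pi_comm {ι κ : Type*} [Fintype ι] [Fintype κ] {E : Type*}
    [MeasurableSpace E] (μ : Measure E) [IsProbabilityMeasure μ]
    (F : (κ → ι → E) → ℝ≥0∞) (hF : Measurable F) :
    ∫⁻ ξ, F (fun a i => ξ i a) ∂(Measure.pi fun _ : ι => Measure.pi fun _ : κ => μ) =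
      ∫⁻ ζ, F ζ ∂(Measure.pi fun _ : κ => Measure.pi fun _ : ι => μ) := by
  have h1 : (Measure.pi fun _ : ι => Measure.pi fun _ : κ => μ).map
      (fun ξ (q : κ × ι) => ξ q.2 q.1) = Measure.pi fun _ : κ × ι => μ := by
    refine (Measure.pi_eq fun s hs => ?_).symm
    rw [Measure.map_apply (by fun_prop) (.univ_pi hs)]
    have : (fun (ξ : ι → κ → E) (q : κ × ι) => ξ q.2 q.1) ⁻¹' (Set.univ.pi s) =
        Set.univ.pi fun i => Set.univ.pi fun a => s (a, i) := by
      ext ξ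
      simp only [Set.mem_preimage, Set.mem_univ_pi, Prod.forall]
      exact forall_comm
    rw [this, Measure.pi_pi]
    simp_rw [Measure.pi_pi]
    rw [Fintype.prod_prod_type, Finset.prod_comm]
  have h2 : (Measure.pi fun _ : κ => Measure.pi fun _ : ι => μ).map
      (fun ξ (q : κ × ι) => ξ q.1 q.2) = Measure.pi fun _ : κ × ι => μ := by
    refine (Measure.pi_eq fun s hs => ?_).symm
    rw [Measure.map_apply (by fun_prop) (.univ_pi hs)]
    have : (fun (ξ : κ → ι → E) (q : κ × ι) => ξ q.1 q.2) ⁻¹' (Set.univ.pi s) =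
        Set.univ.pi fun a => Set.univ.pi fun i => s (a, i) := by
      ext ξ
      simp only [Set.mem_preimage, Set.mem_univ_pi, Prod.forall]
    rw [this, Measure.pi_pi]
    simp_rw [Measure.pi_pi]
    rw [Fintype.prod_prod_type]
  set G : (κ × ι → E) → ℝ≥0∞ := fun w => F (fun a i => w (a, i)) with hG
  have hGm : Measurable G := hF.comp (by fun_prop)
  have e1 := lintegral_map (μ := Measure.pi fun _ : ι => Measure.pi fun _ : κ => μ) hGm
    (g := fun ξ (q : κ × ι) => ξ q.2 q.1) (by fun_prop)
  have e2 := lintegral_map (μ := Measure.pi fun _ : κ => Measure.pi fun _ : ι => μ) hGm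
    (g := fun ξ (q : κ × ι) => ξ q.1 q.2) (by fun_prop)
  rw [h1] at e1
  rw [h2] at e2
  exact e1.symm.trans e2

/-- Independence of the coordinates: if the exponent is a sum of functions of the single coordinates
`a` of all samples, the exponential moment factorizes over `a`. -/
theorem lintegral_exp_sum_columns {ι κ : Type*} [Fintype ι] [Fintype κ]
    (μ : Measure ℝ) [IsProbabilityMeasure μ] (g : κ → (ι → ℝ) → ℝ) (hg : ∀ a, Measurable (g a)) :
    ∫⁻ ξ, ENNReal.ofReal (Real.exp (∑ a, g a (fun i => ξ i a)))
        ∂(Measure.pi fun _ : ι => Measure.pi fun _ : κ => μ) =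
      ∏ a, ∫⁻ w, ENNReal.ofReal (Real.exp (g a w)) ∂(Measure.pi fun _ : ι => μ) := by
  rw [lintegral_pi_pi_comm μ (fun ζ : κ → ι → ℝ => ENNReal.ofReal (Real.exp (∑ a, g a (ζ a))))]
  · rw [← lintegral_pi_prod (fun _ : κ => Measure.pi fun _ : ι => μ)
      (fun a w => ENNReal.ofReal (Real.exp (g a w)))]
    · refine lintegral_congr fun ζ => ?_
      rw [Real.exp_sum, ENNReal.ofReal_prod_of_nonneg fun _ _ => (Real.exp_pos _).le]
    · exact fun a => (Real.measurable_exp.comp (hg a)).ennreal_ofReal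
  · refine (Real.measurable_exp.comp ?_).ennreal_ofReal
    exact Finset.measurable_sum _ fun a _ => (hg a).comp (measurable_pi_apply a)

theorem map_linearForm_pi_gaussianReal {ι : Type*} [Fintype ι] (y : ι → ℝ) :
    (Measure.pi fun _ : ι => gaussianReal 0 1).map (fun w => ∑ i, y i * w i) =
      (gaussianReal 0 1).map (fun z => Real.sqrt (∑ i, y i ^ 2) * z) := by
  have hm : Measurable fun w : ι → ℝ => ∑ i, y i * w i := by fun_prop
  have : IsProbabilityMeasure ((Measure.pi fun _ : ι => gaussianReal 0 1).map
      (fun w => ∑ i, y i * w i)) := Measure.isProbabilityMeasure_map hm.aemeasurable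
  have : IsProbabilityMeasure ((gaussianReal 0 1).map
      (fun z => Real.sqrt (∑ i, y i ^ 2) * z)) :=
    Measure.isProbabilityMeasure_map (by fun_prop)
  apply Measure.ext_of_charFun
  ext t
  rw [gaussianReal_map_const_mul, charFun_gaussianReal, charFun_apply_real,
    integral_map hm.aemeasurable (by fun_prop)]
  have e : ∀ w : ι → ℝ, Complex.exp (t * (∑ i, y i * w i : ℝ) * Complex.I) =
      ∏ i, Complex.exp ((t * y i : ℝ) * w i * Complex.I) := by
    intro w
    rw [← Complex.exp_sum]
    congr 1
    push_cast
    rw [Finset.mul_sum, Finset.sum_mul]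
    exact Finset.sum_congr rfl fun i _ => by ring
  simp_rw [e]
  rw [integral_fintype_prod_eq_prod
    (f := fun i (x : ℝ) => Complex.exp ((t * y i : ℝ) * x * Complex.I))]
  simp_rw [← charFun_apply_real, charFun_gaussianReal]
  rw [← Complex.exp_sum]
  congr 1
  have hs : Real.sqrt (∑ i, y i ^ 2) ^ 2 = ∑ i, y i ^ 2 :=
    Real.sq_sqrt (Finset.sum_nonneg fun _ _ => sq_nonneg _)
  simp only [NNReal.coe_mul, NNReal.coe_mk, hs]
  push_cast
  simp only [mul_zero, zero_mul, zero_sub, mul_one, one_mul]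
  rw [Finset.sum_neg_distrib, Finset.sum_mul, Finset.sum_div]
  congr 1
  exact Finset.sum_congr rfl fun i _ => by ring

/-! ### Exponential moments of the noise form and of the margins -/

/-- The law of `n` independent standard Gaussian vectors in `ℝᵖ`. -/
noncomputable def noiseLaw (n p : ℕ) : Measure (Fin n → Fin p → ℝ) :=
  Measure.pi fun _ : Fin n => Measure.pi fun _ : Fin p => gaussianReal 0 1

instance isProbabilityMeasure_noiseLaw (n p : ℕ) : IsProbabilityMeasure (noiseLaw n p) := by
  unfold noiseLaw; infer_instance

/-- Chernoff's bound, stated for the lower integral so that no integrability is needed. -/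
theorem measure_le_of_lintegral_exp_le {Ω : Type*} [MeasurableSpace Ω] (μ : Measure Ω)
    {X : Ω → ℝ} (hX : Measurable X) {u c : ℝ}
    (h : ∫⁻ ω, ENNReal.ofReal (Real.exp (X ω)) ∂μ ≤ ENNReal.ofReal (Real.exp u)) :
    μ {ω | c ≤ X ω} ≤ ENNReal.ofReal (Real.exp (u - c)) := by
  have h1 := mul_meas_ge_le_lintegral (μ := μ)
    (f := fun ω => ENNReal.ofReal (Real.exp (X ω))) (by fun_prop) (ENNReal.ofReal (Real.exp c))
  have h2 : {ω | ENNReal.ofReal (Real.exp c) ≤ ENNReal.ofReal (Real.exp (X ω))} =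
      {ω | c ≤ X ω} := by
    ext ω
    simp only [Set.mem_ofPred_eq]
    rw [ENNReal.ofReal_le_ofReal_iff (Real.exp_pos _).le, Real.exp_le_exp]
  rw [h2] at h1
  rw [Real.exp_sub, ENNReal.ofReal_div_of_pos (Real.exp_pos _),
    ENNReal.le_div_iff_mul_le (Or.inl (by simp [Real.exp_pos])) (Or.inl ENNReal.ofReal_ne_top),
    mul_comm]
  exact h1.trans h

/-- The quadratic form `yᵀ (Yᵀ Y - ‖θ‖² η ηᵀ - p I) y`. -/
def noiseForm {n p : ℕ} (θ : EuclideanSpace ℝ (Fin p)) (η : Fin n → ℝ)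
    (Y : Matrix (Fin p) (Fin n) ℝ) (y : Fin n → ℝ) : ℝ :=
  ∑ a, ((∑ i, y i * Y a i) ^ 2 - (θ a * ∑ i, y i * η i) ^ 2 - ∑ i, y i ^ 2)

theorem IsLabel.sq_eq_one {n : ℕ} {η : Fin n → ℝ} (hη : IsLabel η) (i : Fin n) :
    η i ^ 2 = 1 := by
  rcases hη i with h | h <;> simp [h]

theorem norm_sq_eq_sum {p : ℕ} (θ : EuclideanSpace ℝ (Fin p)) : ‖θ‖ ^ 2 = ∑ a, θ a ^ 2 :=
  EuclideanSpace.real_norm_sq_eq θ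

/-- Exponential moment of the noise form at a fixed vector of norm at most 2. Both signs of `l` are
covered. -/
theorem lintegral_exp_noiseForm_le {n p : ℕ} (θ : EuclideanSpace ℝ (Fin p)) {η : Fin n → ℝ}
    (hη : IsLabel η) {y : Fin n → ℝ} (hy : ∑ i, y i ^ 2 ≤ 4) {l : ℝ} (hl : |l| ≤ 1 / 16) :
    ∫⁻ ξ, ENNReal.ofReal (Real.exp (l * noiseForm θ η (observation 1 θ η ξ) y))
        ∂(noiseLaw n p) ≤
      ENNReal.ofReal (Real.exp (64 * l ^ 2 * (p + n * ‖θ‖ ^ 2))) := by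
  set q := ∑ i, y i ^ 2 with hq
  set c := ∑ i, y i * η i with hc
  have hq0 : 0 ≤ q := Finset.sum_nonneg fun _ _ => sq_nonneg _
  have hc2 : c ^ 2 ≤ n * q := by
    have := Finset.sum_mul_sq_le_sq_mul_sq Finset.univ y η
    simp only [hη.sq_eq_one, Finset.sum_const, Finset.card_univ, Fintype.card_fin,
      nsmul_eq_mul, mul_one] at this
    linarith
  have hlq : |l * q| ≤ 1 / 4 := by
    rw [abs_mul, abs_of_nonneg hq0]
    nlinarith [abs_nonneg l]
  have e1 : ∀ ξ : Fin n → Fin p → ℝ, l * noiseForm θ η (observation 1 θ η ξ) y =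
      ∑ a, (fun (a : Fin p) (w : Fin n → ℝ) =>
        l * ((θ a * c + ∑ i, y i * w i) ^ 2 - (θ a * c) ^ 2 - q)) a (fun i => ξ i a) := by
    intro ξ
    rw [noiseForm, Finset.mul_sum]
    refine Finset.sum_congr rfl fun a _ => ?_
    have : ∑ i, y i * observation 1 θ η ξ a i = θ a * c + ∑ i, y i * ξ i a := by
      rw [hc, Finset.mul_sum, ← Finset.sum_add_distrib]
      refine Finset.sum_congr rfl fun i _ => ?_
      simp only [observation, Matrix.of_apply]
      ring
    rw [this]
  simp_rw [e1]
  have e0 := lintegral_exp_sum_columns (ι := Fin n) (κ := Fin p) (gaussianReal 0 1)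
    (fun a w => l * ((θ a * c + ∑ i, y i * w i) ^ 2 - (θ a * c) ^ 2 - q)) (fun a => by fun_prop)
  rw [noiseLaw, e0]
  have e2 : ∀ a : Fin p, ∫⁻ w, ENNReal.ofReal (Real.exp
      (l * ((θ a * c + ∑ i, y i * w i) ^ 2 - (θ a * c) ^ 2 - q)))
        ∂(Measure.pi fun _ : Fin n => gaussianReal 0 1) ≤
      ENNReal.ofReal (Real.exp (64 * l ^ 2 * (1 + n * θ a ^ 2))) := by
    intro a
    have h1 := lintegral_map (μ := Measure.pi fun _ : Fin n => gaussianReal 0 1)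
      (f := fun s : ℝ => ENNReal.ofReal (Real.exp
        (l * ((θ a * c + s) ^ 2 - (θ a * c) ^ 2 - q))))
      (g := fun w => ∑ i, y i * w i) (by fun_prop) (by fun_prop)
    rw [← h1, map_linearForm_pi_gaussianReal, lintegral_map (by fun_prop) (by fun_prop), ← hq]
    have e3 : ∀ z : ℝ, ENNReal.ofReal (Real.exp
        (l * ((θ a * c + Real.sqrt q * z) ^ 2 - (θ a * c) ^ 2 - q))) =
        ENNReal.ofReal (Real.exp (-(l * q))) * ENNReal.ofReal (Real.exp
          (l * q * z ^ 2 + 2 * l * (θ a * c) * Real.sqrt q * z)) := by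
      intro z
      rw [← ENNReal.ofReal_mul (Real.exp_pos _).le, ← Real.exp_add]
      congr 2
      linear_combination l * z ^ 2 * Real.sq_sqrt hq0
    simp_rw [e3]
    rw [lintegral_const_mul _ (by fun_prop)]
    refine (mul_le_mul_right (lintegral_exp_quadratic_le hlq) _).trans ?_
    rw [← ENNReal.ofReal_mul (Real.exp_pos _).le, ← Real.exp_add]
    apply ENNReal.ofReal_le_ofReal
    rw [Real.exp_le_exp]
    have hden : 1 ≤ 2 * (1 - 2 * (l * q)) := by linarith [(abs_le.1 hlq).2]
    have h4 : (2 * l * (θ a * c) * Real.sqrt q) ^ 2 / (2 * (1 - 2 * (l * q))) ≤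
        (2 * l * (θ a * c) * Real.sqrt q) ^ 2 := div_le_self (sq_nonneg _) hden
    have h5 : (2 * l * (θ a * c) * Real.sqrt q) ^ 2 = 4 * l ^ 2 * θ a ^ 2 * (c ^ 2 * q) := by
      linear_combination (4 * l ^ 2 * θ a ^ 2 * c ^ 2) * Real.sq_sqrt hq0
    have h6 : c ^ 2 * q ≤ n * 16 := by
      have : q * q ≤ 4 * 4 := mul_le_mul hy hy hq0 (by norm_num)
      calc c ^ 2 * q ≤ n * q * q := mul_le_mul_of_nonneg_right hc2 hq0
        _ = n * (q * q) := by ring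
        _ ≤ n * 16 := by
          apply mul_le_mul_of_nonneg_left _ (Nat.cast_nonneg n)
          linarith
    have h7 : 4 * l ^ 2 * θ a ^ 2 * (c ^ 2 * q) ≤ 4 * l ^ 2 * θ a ^ 2 * (n * 16) :=
      mul_le_mul_of_nonneg_left h6 (by positivity)
    have h8 : (l * q) ^ 2 ≤ l ^ 2 * 16 := by
      rw [mul_pow]
      apply mul_le_mul_of_nonneg_left _ (sq_nonneg l)
      nlinarith
    nlinarith [sq_nonneg l]
  refine (Finset.prod_le_prod' fun a _ => e2 a).trans_eq ?_
  rw [← ENNReal.ofReal_prod_of_nonneg fun _ _ => (Real.exp_pos _).le, ← Real.exp_sum,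
    ← Finset.mul_sum, Finset.sum_add_distrib, ← Finset.mul_sum, norm_sq_eq_sum]
  simp

/-- The `i`-th coordinate of `H(Yᵀ Y) η`, multiplied by the label `ηᵢ`: the margin with which
the sample `i` is classified correctly when all other labels are known. -/
noncomputable def margin {n p : ℕ} (η : Fin n → ℝ) (Y : Matrix (Fin p) (Fin n) ℝ)
    (i : Fin n) : ℝ :=
  η i * (hollowGram Y).mulVec η i

theorem margin_observation {m p : ℕ} (θ : EuclideanSpace ℝ (Fin p)) {η : Fin (m + 1) → ℝ}
    (hη : IsLabel η) (ξ : Fin (m + 1) → Fin p → ℝ) (i : Fin (m + 1)) :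
    margin η (observation 1 θ η ξ) i =
      ∑ a, (θ a + η i * ξ i a) *
        (m * θ a + ∑ j : Fin m, η (i.succAbove j) * ξ (i.succAbove j) a) := by
  have hne : ∀ j : Fin m, i ≠ i.succAbove j := fun j => (Fin.succAbove_ne i j).symm
  rw [margin, Matrix.mulVec, dotProduct, Fin.sum_univ_succAbove _ i]
  simp only [hollowGram, hollow, Matrix.sub_apply, Matrix.diagonal_apply_eq, Matrix.diag_apply,
    sub_self, zero_mul, zero_add]
  simp only [Matrix.diagonal_apply_ne _ (hne _), sub_zero, Matrix.mul_apply,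
    Matrix.transpose_apply, observation, Matrix.of_apply]
  rw [Finset.mul_sum]
  simp_rw [Finset.sum_mul, Finset.mul_sum]
  rw [Finset.sum_comm]
  refine Finset.sum_congr rfl fun a _ => ?_
  have h : ∀ j : Fin m, η i * ((θ a * η i + 1 * ξ i a) *
      (θ a * η (i.succAbove j) + 1 * ξ (i.succAbove j) a) * η (i.succAbove j)) =
      (θ a + η i * ξ i a) * (θ a + η (i.succAbove j) * ξ (i.succAbove j) a) := by
    intro j
    have h1 := hη.sq_eq_one i
    have h2 := hη.sq_eq_one (i.succAbove j)
    linear_combination (θ a * (θ a * η (i.succAbove j) + ξ (i.succAbove j) a) *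
      η (i.succAbove j)) * h1 + (θ a ^ 2 + η i * ξ i a * θ a) * h2
  simp_rw [h]
  rw [← Finset.mul_sum, Finset.sum_add_distrib]
  simp

/-- Contribution of one coordinate to the exponential moment of a margin: the noise of the other
samples is integrated first, where the exponent is linear, and the noise of the sample `i` second,
where the exponent is quadratic. -/
theorem lintegral_exp_bilinear_le {m : ℕ} {η : Fin (m + 1) → ℝ} (hη : IsLabel η)
    (i : Fin (m + 1)) (t l : ℝ) (hl : l ^ 2 * m ≤ 1 / 2) :
    ∫⁻ w, ENNReal.ofReal (Real.exp (-l * ((t + η i * w i) *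
        (m * t + ∑ j : Fin m, η (i.succAbove j) * w (i.succAbove j)))))
        ∂(Measure.pi fun _ : Fin (m + 1) => gaussianReal 0 1) ≤
      ENNReal.ofReal (Real.exp (t ^ 2 * (l ^ 2 * m / 2 - l * m +
        (l ^ 2 * m - l * m) ^ 2 / (2 * (1 - l ^ 2 * m))) +
        (l ^ 2 * m / 2 + 2 * (l ^ 2 * m / 2) ^ 2))) := by
  have hmp := measurePreserving_piFinSuccAbove (fun _ : Fin (m + 1) => gaussianReal 0 1) i
  set F : ℝ × (Fin m → ℝ) → ℝ≥0∞ := fun u => ENNReal.ofReal (Real.exp (-l * ((t + η i * u.1) *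
        (m * t + ∑ j : Fin m, η (i.succAbove j) * u.2 j)))) with hF
  have hFm : Measurable F := by fun_prop
  have e1 := hmp.lintegral_comp hFm
  have e0 : ∫⁻ w, ENNReal.ofReal (Real.exp (-l * ((t + η i * w i) *
        (m * t + ∑ j : Fin m, η (i.succAbove j) * w (i.succAbove j)))))
        ∂(Measure.pi fun _ : Fin (m + 1) => gaussianReal 0 1) =
      ∫⁻ u, F u ∂((gaussianReal 0 1).prod (Measure.pi fun _ : Fin m => gaussianReal 0 1)) := by
    rw [← e1]
    rfl
  rw [e0, lintegral_prod _ hFm.aemeasurable]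
  have e2 : ∀ z : ℝ, ∫⁻ w, F (z, w) ∂(Measure.pi fun _ : Fin m => gaussianReal 0 1) =
      ENNReal.ofReal (Real.exp (-(l * m * t * (t + η i * z)) +
        l ^ 2 * m * (t + η i * z) ^ 2 / 2)) := by
    intro z
    have h1 := lintegral_map (μ := Measure.pi fun _ : Fin m => gaussianReal 0 1)
      (f := fun s : ℝ => ENNReal.ofReal (Real.exp (-l * ((t + η i * z) * (m * t + s)))))
      (g := fun w => ∑ j : Fin m, η (i.succAbove j) * w j) (by fun_prop) (by fun_prop)
    simp only [hF]
    rw [← h1, map_linearForm_pi_gaussianReal, lintegral_map (by fun_prop) (by fun_prop)]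
    simp only [hη.sq_eq_one, Finset.sum_const, Finset.card_univ, Fintype.card_fin,
      nsmul_eq_mul, mul_one]
    have e3 : ∀ s : ℝ, ENNReal.ofReal (Real.exp
        (-l * ((t + η i * z) * (m * t + Real.sqrt m * s)))) =
        ENNReal.ofReal (Real.exp (-(l * m * t * (t + η i * z)))) * ENNReal.ofReal (Real.exp
          (0 * s ^ 2 + (-l * (t + η i * z) * Real.sqrt m) * s)) := by
      intro s
      rw [← ENNReal.ofReal_mul (Real.exp_pos _).le, ← Real.exp_add]
      congr 2
      ring
    simp_rw [e3]
    rw [lintegral_const_mul _ (by fun_prop),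
      lintegral_exp_quadratic_gaussianReal (by norm_num),
      ← ENNReal.ofReal_mul (Real.exp_pos _).le, mul_zero, sub_zero, Real.sqrt_one, inv_one,
      one_mul, ← Real.exp_add]
    congr 2
    linear_combination (l ^ 2 * (t + η i * z) ^ 2 / 2) * Real.sq_sqrt (Nat.cast_nonneg (α := ℝ) m)
  simp_rw [e2]
  have e4 : ∀ z : ℝ, ENNReal.ofReal (Real.exp (-(l * m * t * (t + η i * z)) +
        l ^ 2 * m * (t + η i * z) ^ 2 / 2)) =
      ENNReal.ofReal (Real.exp (t ^ 2 * (l ^ 2 * m / 2 - l * m))) * ENNReal.ofReal (Real.exp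
        (l ^ 2 * m / 2 * z ^ 2 + (l ^ 2 * m - l * m) * t * η i * z)) := by
    intro z
    rw [← ENNReal.ofReal_mul (Real.exp_pos _).le, ← Real.exp_add]
    congr 2
    linear_combination (l ^ 2 * m / 2 * z ^ 2) * hη.sq_eq_one i
  simp_rw [e4]
  rw [lintegral_const_mul _ (by fun_prop)]
  refine (mul_le_mul_right (lintegral_exp_quadratic_le ?_) _).trans ?_
  · rw [abs_of_nonneg (by positivity)]
    linarith
  rw [← ENNReal.ofReal_mul (Real.exp_pos _).le, ← Real.exp_add]
  refine le_of_eq ?_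
  congr 2
  rw [mul_pow ((l ^ 2 * m - l * m) * t), hη.sq_eq_one i]
  ring

/-! ### Lower tail of the margins and quadratic forms of symmetric matrices -/

/-- The exponent in Chernoff's bound for a margin. At `μ = s² / (s² + p/N)` the leading terms
`-s² μ + μ² (s² + p/N) / 2` equal `-s² μ / 2`; the remaining ones are of relative order `1/N`. -/
theorem margin_exponent_le {s p N μ : ℝ} (hp : 0 ≤ p) (hN : 2 ≤ N) (hμ0 : 0 ≤ μ) (hμ1 : μ ≤ 1)
    (hμ : μ * (s ^ 2 + p / N) = s ^ 2) :
    s ^ 2 * ((μ / N) ^ 2 * (N - 1) / 2 - μ / N * (N - 1) +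
        ((μ / N) ^ 2 * (N - 1) - μ / N * (N - 1)) ^ 2 / (2 * (1 - (μ / N) ^ 2 * (N - 1)))) +
      p * ((μ / N) ^ 2 * (N - 1) / 2 + 2 * ((μ / N) ^ 2 * (N - 1) / 2) ^ 2) ≤
    -(s ^ 2 * μ) / 2 + 3 * (s ^ 2 * μ) / N := by
  have hN0 : 0 < N := by linarith
  set x := (μ / N) ^ 2 * (N - 1) with hx
  set y := μ / N * (N - 1) with hy
  have hl0 : 0 ≤ μ / N := by positivity
  have hl1 : μ / N ≤ 1 := by rw [div_le_one hN0]; linarith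
  have hy0 : 0 ≤ y := mul_nonneg hl0 (by linarith)
  have hyeq : y = μ - μ / N := by rw [hy]; field_simp
  have hyμ : y ≤ μ := by linarith
  have hx0 : 0 ≤ x := mul_nonneg (sq_nonneg _) (by linarith)
  have hxy : x ≤ y := by
    have : x = μ / N * y := by rw [hx, hy]; ring
    rw [this]
    exact mul_le_of_le_one_left hy0 hl1
  have hμμ : μ ^ 2 ≤ μ := by nlinarith
  have hxN : x ≤ μ ^ 2 / N := by
    rw [hx, div_pow, div_mul_eq_mul_div, div_le_div_iff₀ (by positivity) hN0]
    have : 0 ≤ μ ^ 2 * N := by positivity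
    nlinarith
  have hxN' : x ≤ 1 / N := hxN.trans (by gcongr; nlinarith)
  have h1N : 1 / N ≤ 1 / 2 := by gcongr
  have hx2 : x ≤ 1 / 2 := hxN'.trans h1N
  have hfrac : (x - y) ^ 2 / (2 * (1 - x)) ≤ μ ^ 2 * (1 + 2 * x) / 2 := by
    rw [div_le_div_iff₀ (by linarith) (by norm_num)]
    have h1 : (x - y) ^ 2 ≤ μ ^ 2 := by
      apply sq_le_sq' <;> linarith
    have h2 : 1 ≤ (1 + 2 * x) * (1 - x) := by nlinarith
    have h3 : 0 ≤ μ ^ 2 := sq_nonneg _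
    nlinarith
  have hs : 0 ≤ s ^ 2 := sq_nonneg _
  have hμN : μ ^ 2 / N ≤ μ / N := by gcongr
  have hμxN : μ ^ 2 * x ≤ μ / N := by
    calc μ ^ 2 * x ≤ 1 * (μ / N) :=
          mul_le_mul (by nlinarith) (hxN.trans hμN) hx0 zero_le_one
      _ = μ / N := one_mul _
  have hpN : p / N * μ = s ^ 2 - s ^ 2 * μ := by linarith
  have hpart1 : s ^ 2 * (x / 2 - y + (x - y) ^ 2 / (2 * (1 - x))) ≤
      s ^ 2 * (-μ + μ ^ 2 / 2 + 5 / 2 * (μ / N)) := by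
    apply mul_le_mul_of_nonneg_left _ hs
    rw [hyeq] at hfrac ⊢
    linarith
  have hpart2 : p * (x / 2 + 2 * (x / 2) ^ 2) ≤ (s ^ 2 - s ^ 2 * μ) * μ / 2 * (1 + 1 / N) := by
    have h1 : p * (x / 2 + 2 * (x / 2) ^ 2) = p * x / 2 * (1 + x) := by ring
    have h2 : p * x ≤ (s ^ 2 - s ^ 2 * μ) * μ := by
      calc p * x ≤ p * (μ ^ 2 / N) := mul_le_mul_of_nonneg_left hxN hp
        _ = (p / N * μ) * μ := by ring
        _ = _ := by rw [hpN]
    have h3 : 0 ≤ p * x := mul_nonneg hp hx0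
    rw [h1]
    exact mul_le_mul (by linarith) (by linarith) (by linarith) (by linarith)
  have h4 : (s ^ 2 - s ^ 2 * μ) * μ / 2 * (1 / N) ≤ s ^ 2 * μ / 2 * (1 / N) := by
    apply mul_le_mul_of_nonneg_right _ (by positivity)
    nlinarith [mul_nonneg hs (sq_nonneg μ)]
  have h5 : 3 * (s ^ 2 * μ) / N = s ^ 2 * (5 / 2 * (μ / N)) + s ^ 2 * μ / 2 * (1 / N) := by
    field_simp; ring
  rw [h5]
  linarith

/-- The squared signal-to-noise ratio `‖θ‖⁴ / (‖θ‖² + p/n)` at noise level one. -/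
noncomputable def snrSq (n p : ℕ) (s : ℝ) : ℝ := s ^ 2 * (s ^ 2 / (s ^ 2 + (p : ℝ) / n))

/-- Lower tail of a margin, with the sharp constant in the exponent. -/
theorem measure_margin_le {n p : ℕ} (hn : 2 ≤ n) (θ : EuclideanSpace ℝ (Fin p))
    (hθ : 0 < ‖θ‖) {η : Fin n → ℝ} (hη : IsLabel η) (i : Fin n) (δ : ℝ) :
    noiseLaw n p {ξ | margin η (observation 1 θ η ξ) i ≤ δ * n * ‖θ‖ ^ 2} ≤
      ENNReal.ofReal (Real.exp (-(snrSq n p ‖θ‖) / 2 + 3 * snrSq n p ‖θ‖ / n +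
        δ * snrSq n p ‖θ‖)) := by
  obtain ⟨m, rfl⟩ : ∃ m, n = m + 1 := ⟨n - 1, by omega⟩
  have hN : (2 : ℝ) ≤ ((m + 1 : ℕ) : ℝ) := by exact_mod_cast hn
  have hm : (m : ℝ) = ((m + 1 : ℕ) : ℝ) - 1 := by push_cast; ring
  set N : ℝ := ((m + 1 : ℕ) : ℝ) with hNdef
  have hN0 : 0 < N := by linarith
  set μ := ‖θ‖ ^ 2 / (‖θ‖ ^ 2 + (p : ℝ) / N) with hμdef
  have hden : 0 < ‖θ‖ ^ 2 + (p : ℝ) / N := by positivity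
  have hμ0 : 0 < μ := by positivity
  have hμ1 : μ ≤ 1 := by
    rw [hμdef, div_le_one hden]
    have : 0 ≤ (p : ℝ) / N := by positivity
    linarith
  have hμ : μ * (‖θ‖ ^ 2 + p / N) = ‖θ‖ ^ 2 := div_mul_cancel₀ _ hden.ne'
  have hr : snrSq (m + 1) p ‖θ‖ = ‖θ‖ ^ 2 * μ := rfl
  have hl0 : 0 < μ / N := by positivity
  have hlm : (μ / N) ^ 2 * (m : ℝ) ≤ 1 / 2 := by
    rw [hm, div_pow, div_mul_eq_mul_div, div_le_div_iff₀ (by positivity) (by norm_num)]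
    nlinarith [mul_nonneg hμ0.le hN0.le, sq_nonneg N, mul_pos hN0 hN0]
  have hmeas : ∀ i, Measurable fun ξ : Fin (m + 1) → Fin p → ℝ =>
      -(μ / N) * margin η (observation 1 θ η ξ) i := by
    intro i
    simp_rw [margin_observation θ hη]
    fun_prop
  have hsum : ∀ ξ : Fin (m + 1) → Fin p → ℝ,
      -(μ / N) * margin η (observation 1 θ η ξ) i =
      ∑ a, (fun (a : Fin p) (w : Fin (m + 1) → ℝ) => -(μ / N) * ((θ a + η i * w i) *
        (m * θ a + ∑ j : Fin m, η (i.succAbove j) * w (i.succAbove j)))) a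
          (fun i => ξ i a) := by
    intro ξ
    rw [margin_observation θ hη, Finset.mul_sum]
  have hmgf : ∫⁻ ξ, ENNReal.ofReal (Real.exp (-(μ / N) * margin η (observation 1 θ η ξ) i))
      ∂(noiseLaw (m + 1) p) ≤ ENNReal.ofReal (Real.exp
        (-(‖θ‖ ^ 2 * μ) / 2 + 3 * (‖θ‖ ^ 2 * μ) / N)) := by
    have e0 := lintegral_exp_sum_columns (ι := Fin (m + 1)) (κ := Fin p) (gaussianReal 0 1)
      (fun a w => -(μ / N) * ((θ a + η i * w i) *
        (m * θ a + ∑ j : Fin m, η (i.succAbove j) * w (i.succAbove j)))) (fun a => by fun_prop)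
    simp_rw [hsum]
    rw [noiseLaw, e0]
    refine (Finset.prod_le_prod' fun a _ =>
      lintegral_exp_bilinear_le hη i (θ a) (μ / N) hlm).trans ?_
    rw [← ENNReal.ofReal_prod_of_nonneg fun _ _ => (Real.exp_pos _).le, ← Real.exp_sum]
    apply ENNReal.ofReal_le_ofReal
    rw [Real.exp_le_exp, Finset.sum_add_distrib, ← Finset.sum_mul, ← norm_sq_eq_sum]
    simp only [Finset.sum_const, Finset.card_univ, Fintype.card_fin, nsmul_eq_mul]
    rw [hm]
    exact margin_exponent_le (Nat.cast_nonneg p) hN hμ0.le hμ1 hμ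
  have h := measure_le_of_lintegral_exp_le (noiseLaw (m + 1) p) (hmeas i)
    (c := -(μ / N) * (δ * N * ‖θ‖ ^ 2)) hmgf
  have hset : {ξ : Fin (m + 1) → Fin p → ℝ |
      margin η (observation 1 θ η ξ) i ≤ δ * N * ‖θ‖ ^ 2} =
      {ξ | -(μ / N) * (δ * N * ‖θ‖ ^ 2) ≤ -(μ / N) * margin η (observation 1 θ η ξ) i} := by
    ext ξ
    simp only [Set.mem_ofPred_eq, neg_mul, neg_le_neg_iff]
    exact (mul_le_mul_iff_right₀ hl0).symm
  rw [hset, hr]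
  refine h.trans_eq ?_
  congr 2
  field_simp
  ring

theorem quadForm_add {n : ℕ} {A : Matrix (Fin n) (Fin n) ℝ} (hA : A.IsSymm) (x y : Fin n → ℝ) :
    (x + y) ⬝ᵥ A.mulVec (x + y) = x ⬝ᵥ A.mulVec x + 2 * (x ⬝ᵥ A.mulVec y) + y ⬝ᵥ A.mulVec y := by
  have h : y ⬝ᵥ A.mulVec x = x ⬝ᵥ A.mulVec y := by
    rw [dotProduct_comm, Matrix.dotProduct_mulVec, ← Matrix.mulVec_transpose, hA.eq]
  rw [Matrix.mulVec_add, add_dotProduct, dotProduct_add, dotProduct_add, h]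
  ring

theorem quadForm_smul {n : ℕ} (A : Matrix (Fin n) (Fin n) ℝ) (c : ℝ) (x : Fin n → ℝ) :
    (c • x) ⬝ᵥ A.mulVec (c • x) = c ^ 2 * (x ⬝ᵥ A.mulVec x) := by
  rw [Matrix.mulVec_smul, smul_dotProduct, dotProduct_smul, smul_eq_mul, smul_eq_mul]
  ring

/-- Polarization: a bound on a quadratic form bounds the bilinear form it comes from. -/
theorem abs_bilin_le {n : ℕ} {A : Matrix (Fin n) (Fin n) ℝ} (hA : A.IsSymm) {κ : ℝ}
    (h : ∀ x : Fin n → ℝ, |x ⬝ᵥ A.mulVec x| ≤ κ * (x ⬝ᵥ x)) (x y : Fin n → ℝ) :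
    2 * |x ⬝ᵥ A.mulVec y| ≤ κ * (x ⬝ᵥ x + y ⬝ᵥ y) := by
  have h1 := h (x + y)
  have h2 := h (x + (-1 : ℝ) • y)
  rw [quadForm_add hA] at h1 h2
  rw [quadForm_smul, Matrix.mulVec_smul, dotProduct_smul] at h2
  have e1 : (x + y) ⬝ᵥ (x + y) = x ⬝ᵥ x + 2 * (x ⬝ᵥ y) + y ⬝ᵥ y := by
    rw [add_dotProduct, dotProduct_add, dotProduct_add, dotProduct_comm y x]; ring
  have e2 : (x + (-1 : ℝ) • y) ⬝ᵥ (x + (-1 : ℝ) • y) = x ⬝ᵥ x - 2 * (x ⬝ᵥ y) + y ⬝ᵥ y := by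
    simp only [add_dotProduct, dotProduct_add, smul_dotProduct, dotProduct_smul,
      dotProduct_comm y x, smul_eq_mul]
    ring
  rw [e1] at h1
  rw [e2] at h2
  rw [smul_eq_mul] at h2
  obtain ⟨h3, h4⟩ := abs_le.1 h1
  obtain ⟨h5, h6⟩ := abs_le.1 h2
  have : |x ⬝ᵥ A.mulVec y| ≤ κ * (x ⬝ᵥ x + y ⬝ᵥ y) / 2 := by
    rw [abs_le]; constructor <;> linarith
  linarith

theorem norm_sq_eq_dotProduct {n : ℕ} (x : EuclideanSpace ℝ (Fin n)) :
    ‖x‖ ^ 2 = x.ofLp ⬝ᵥ x.ofLp := by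
  rw [EuclideanSpace.real_norm_sq_eq, dotProduct]
  exact Finset.sum_congr rfl fun i _ => sq _

/-- If a quadratic form exceeds the level `κ` somewhere, it is at least `κ / 3` on a whole ball of
radius `1/4` about a unit vector, namely about a maximizer on the unit sphere. -/
theorem exists_ball_le_abs_quadForm {n : ℕ} {A : Matrix (Fin n) (Fin n) ℝ} (hA : A.IsSymm)
    {κ : ℝ} (hκ : 0 ≤ κ) (h : ∃ x : Fin n → ℝ, κ * (x ⬝ᵥ x) < |x ⬝ᵥ A.mulVec x|) :
    ∃ v : EuclideanSpace ℝ (Fin n), ‖v‖ = 1 ∧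
      ∀ y ∈ Metric.ball v (1 / 4), κ / 3 ≤ |y.ofLp ⬝ᵥ A.mulVec y.ofLp| := by
  obtain ⟨x, hx⟩ := h
  have hx0 : WithLp.toLp 2 x ≠ 0 := by
    intro h0
    have : x = 0 := by simpa using congrArg WithLp.ofLp h0
    simp [this] at hx
  have hxn : 0 < ‖WithLp.toLp 2 x‖ := norm_pos_iff.2 hx0
  have hnorm : ∀ (y : EuclideanSpace ℝ (Fin n)), 0 < ‖y‖ → ‖(‖y‖⁻¹ • y)‖ = 1 := by
    intro y hy
    rw [norm_smul, norm_inv, norm_norm, inv_mul_cancel₀ hy.ne']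
  have hcont : Continuous fun y : EuclideanSpace ℝ (Fin n) =>
      |y.ofLp ⬝ᵥ A.mulVec y.ofLp| := by
    simp only [dotProduct, Matrix.mulVec]
    fun_prop
  obtain ⟨v, hv, hmax⟩ := (isCompact_sphere (0 : EuclideanSpace ℝ (Fin n)) 1).exists_isMaxOn
    ⟨‖WithLp.toLp 2 x‖⁻¹ • WithLp.toLp 2 x, by simpa using hnorm _ hxn⟩ hcont.continuousOn
  have hv1 : ‖v‖ = 1 := by simpa using hv
  set K := |v.ofLp ⬝ᵥ A.mulVec v.ofLp| with hK
  have hall : ∀ y : Fin n → ℝ, |y ⬝ᵥ A.mulVec y| ≤ K * (y ⬝ᵥ y) := by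
    intro y
    rcases eq_or_ne (WithLp.toLp 2 y) 0 with h0 | h0
    · have : y = 0 := by simpa using congrArg WithLp.ofLp h0
      simp [this]
    · have hyn : 0 < ‖WithLp.toLp 2 y‖ := norm_pos_iff.2 h0
      have h1 := hmax (a := ‖WithLp.toLp 2 y‖⁻¹ • WithLp.toLp 2 y)
        (by simpa using hnorm _ hyn)
      simp only [Set.mem_ofPred_eq, WithLp.ofLp_smul, quadForm_smul] at h1
      have h2 := norm_sq_eq_dotProduct (WithLp.toLp 2 y)
      simp only at h2
      rw [← h2]
      rw [abs_mul, abs_of_nonneg (by positivity), inv_pow, inv_mul_le_iff₀ (by positivity)] at h1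
      linarith
  have hκK : κ < K := by
    have h1 := hall x
    have h2 : 0 < x ⬝ᵥ x := by
      have := norm_sq_eq_dotProduct (WithLp.toLp 2 x)
      simp only at this
      rw [← this]; positivity
    by_contra hc
    have := mul_le_mul_of_nonneg_right (not_lt.1 hc) h2.le
    linarith
  refine ⟨v, hv1, fun y hy => ?_⟩
  set w : Fin n → ℝ := y.ofLp - v.ofLp with hw
  have hyw : y.ofLp = v.ofLp + w := by rw [hw]; abel
  have hvv : v.ofLp ⬝ᵥ v.ofLp = 1 := by rw [← norm_sq_eq_dotProduct, hv1]; norm_num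
  have hww : w ⬝ᵥ w ≤ 1 / 16 := by
    have h1 : ‖y - v‖ < 1 / 4 := by simpa [dist_eq_norm] using hy
    have h2 := norm_sq_eq_dotProduct (y - v)
    rw [WithLp.ofLp_sub, ← hw] at h2
    rw [← h2]
    nlinarith [norm_nonneg (y - v)]
  have hb := abs_bilin_le hA hall v.ofLp ((4 : ℝ) • w)
  have hq := hall w
  rw [Matrix.mulVec_smul, dotProduct_smul, smul_dotProduct, dotProduct_smul, smul_eq_mul,
    smul_eq_mul, smul_eq_mul, abs_mul, abs_of_pos (by norm_num : (0 : ℝ) < 4), hvv] at hb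
  rw [hyw, quadForm_add hA]
  have hK0 : 0 ≤ K := abs_nonneg _
  have hb' : |v.ofLp ⬝ᵥ A.mulVec w| ≤ K / 4 := by nlinarith
  have hq' : |w ⬝ᵥ A.mulVec w| ≤ K / 16 := by nlinarith
  have h3 : K - 2 * (K / 4) - K / 16 ≤
      |v.ofLp ⬝ᵥ A.mulVec v.ofLp + 2 * (v.ofLp ⬝ᵥ A.mulVec w) + w ⬝ᵥ A.mulVec w| := by
    have t1 := abs_sub_abs_le_abs_sub (v.ofLp ⬝ᵥ A.mulVec v.ofLp)
      (-(2 * (v.ofLp ⬝ᵥ A.mulVec w) + w ⬝ᵥ A.mulVec w))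
    rw [abs_neg, sub_neg_eq_add, ← add_assoc] at t1
    have t2 := abs_add_le (2 * (v.ofLp ⬝ᵥ A.mulVec w)) (w ⬝ᵥ A.mulVec w)
    rw [abs_mul, abs_of_pos (by norm_num : (0 : ℝ) < 2)] at t2
    linarith
  linarith

/-! ### Concentration of the noise matrix -/

/-- The matrix `Yᵀ Y - ‖θ‖² η ηᵀ - p I`, the fluctuation of the Gram matrix. -/
noncomputable def noiseMatrix {n p : ℕ} (θ : EuclideanSpace ℝ (Fin p)) (η : Fin n → ℝ)
    (Y : Matrix (Fin p) (Fin n) ℝ) : Matrix (Fin n) (Fin n) ℝ :=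
  Y.transpose * Y - ‖θ‖ ^ 2 • Matrix.vecMulVec η η - (p : ℝ) • (1 : Matrix (Fin n) (Fin n) ℝ)

theorem noiseMatrix_isSymm {n p : ℕ} (θ : EuclideanSpace ℝ (Fin p)) (η : Fin n → ℝ)
    (Y : Matrix (Fin p) (Fin n) ℝ) : (noiseMatrix θ η Y).IsSymm := by
  unfold noiseMatrix Matrix.IsSymm
  simp [Matrix.transpose_mul, Matrix.transpose_vecMulVec]

theorem dotProduct_noiseMatrix {n p : ℕ} (θ : EuclideanSpace ℝ (Fin p)) (η : Fin n → ℝ)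
    (Y : Matrix (Fin p) (Fin n) ℝ) (y : Fin n → ℝ) :
    y ⬝ᵥ (noiseMatrix θ η Y).mulVec y = noiseForm θ η Y y := by
  have h1 : y ⬝ᵥ (Y.transpose * Y).mulVec y = ∑ a, (∑ i, y i * Y a i) ^ 2 := by
    rw [← Matrix.mulVec_mulVec, Matrix.dotProduct_mulVec, Matrix.vecMul_transpose, dotProduct]
    refine Finset.sum_congr rfl fun a _ => ?_
    rw [sq, Matrix.mulVec, dotProduct_comm]
    rfl
  have h2 : y ⬝ᵥ (Matrix.vecMulVec η η).mulVec y = (∑ i, y i * η i) ^ 2 := by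
    rw [Matrix.vecMulVec_mulVec, dotProduct_smul, dotProduct_comm η y]
    simp [dotProduct, sq]
  rw [noiseMatrix, Matrix.sub_mulVec, Matrix.sub_mulVec, dotProduct_sub, dotProduct_sub,
    Matrix.smul_mulVec, Matrix.smul_mulVec, dotProduct_smul, dotProduct_smul, h1, h2,
    Matrix.one_mulVec, noiseForm, Finset.sum_sub_distrib, Finset.sum_sub_distrib, norm_sq_eq_sum]
  simp only [mul_pow, Finset.sum_const, Finset.card_univ, Fintype.card_fin, nsmul_eq_mul,
    smul_eq_mul, ← Finset.sum_mul, dotProduct, ← sq]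

theorem measurable_noiseForm_observation {n p : ℕ} (θ : EuclideanSpace ℝ (Fin p))
    (η : Fin n → ℝ) :
    Measurable fun q : (Fin n → Fin p → ℝ) × EuclideanSpace ℝ (Fin n) =>
      noiseForm θ η (observation 1 θ η q.1) q.2.ofLp := by
  simp only [noiseForm, observation, Matrix.of_apply]
  fun_prop

/-- The operator norm of the noise matrix concentrates. Instead of a net, the exponential moment
is averaged over a ball of radius 2, which contains the ball of radius `1/4` on which the quadratic
form is large, and which is `8ⁿ` times larger. -/
theorem measure_noiseForm_gt_le {n p : ℕ} (θ : EuclideanSpace ℝ (Fin p)) {η : Fin n → ℝ}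
    (hη : IsLabel η) {κ l : ℝ} (hκ : 0 ≤ κ) (hl0 : 0 ≤ l) (hl : l ≤ 1 / 16) :
    noiseLaw n p {ξ | ∃ y : Fin n → ℝ,
        κ * (y ⬝ᵥ y) < |noiseForm θ η (observation 1 θ η ξ) y|} ≤
      ENNReal.ofReal (2 * 8 ^ n *
        Real.exp (64 * l ^ 2 * (p + n * ‖θ‖ ^ 2) - l * κ / 3)) := by
  set f : (Fin n → Fin p → ℝ) → EuclideanSpace ℝ (Fin n) → ℝ := fun ξ y =>
    noiseForm θ η (observation 1 θ η ξ) y.ofLp with hf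
  have hfm : Measurable (Function.uncurry f) := measurable_noiseForm_observation θ η
  set g : (Fin n → Fin p → ℝ) → EuclideanSpace ℝ (Fin n) → ℝ≥0∞ := fun ξ y =>
    ENNReal.ofReal (Real.exp (l * f ξ y)) + ENNReal.ofReal (Real.exp (-l * f ξ y)) with hg
  have hgm : Measurable (Function.uncurry g) := by
    have h1 : Measurable fun q : (Fin n → Fin p → ℝ) × EuclideanSpace ℝ (Fin n) =>
      ENNReal.ofReal (Real.exp (l * Function.uncurry f q)) +
        ENNReal.ofReal (Real.exp (-l * Function.uncurry f q)) := by fun_prop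
    exact h1
  set B : Set (EuclideanSpace ℝ (Fin n)) := Metric.ball 0 2 with hB
  set M : ℝ := Real.exp (64 * l ^ 2 * (p + n * ‖θ‖ ^ 2)) with hM
  have hM0 : 0 < M := Real.exp_pos _
  set G : (Fin n → Fin p → ℝ) → ℝ≥0∞ := fun ξ => ∫⁻ y in B, g ξ y with hG
  have hGm : Measurable G := Measurable.lintegral_prod_right hgm
  have hV0 : volume (Metric.ball (0 : EuclideanSpace ℝ (Fin n)) (1 / 4)) ≠ 0 :=
    (Metric.measure_ball_pos _ _ (by norm_num)).ne'
  have hVt : volume (Metric.ball (0 : EuclideanSpace ℝ (Fin n)) (1 / 4)) ≠ ∞ :=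
    measure_ball_lt_top.ne
  set V := volume (Metric.ball (0 : EuclideanSpace ℝ (Fin n)) (1 / 4)) with hV
  have hBV : volume B = ENNReal.ofReal (8 ^ n) * V := by
    have h1 := Measure.addHaar_ball_mul_of_pos (volume : Measure (EuclideanSpace ℝ (Fin n))) 0
      (by norm_num : (0 : ℝ) < 8) (1 / 4)
    rw [finrank_euclideanSpace_fin] at h1
    rw [hB, hV, ← h1]
    norm_num
  -- The mean of `G` is at most `vol (ball 0 2)` times the bound on the exponential moments.
  have hupper : ∫⁻ ξ, G ξ ∂(noiseLaw n p) ≤ ENNReal.ofReal (2 * M) * volume B := by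
    rw [hG, lintegral_lintegral_swap hgm.aemeasurable]
    refine (setLIntegral_mono' (g := fun _ => ENNReal.ofReal (2 * M)) measurableSet_ball
      fun y hy => ?_).trans_eq (by rw [setLIntegral_const])
    have hy4 : ∑ i, y.ofLp i ^ 2 ≤ 4 := by
      rw [← EuclideanSpace.real_norm_sq_eq]
      have : ‖y‖ < 2 := by simpa [hB] using hy
      nlinarith [norm_nonneg y]
    have habs : |l| ≤ 1 / 16 := by rwa [abs_of_nonneg hl0]
    have hm1 : Measurable fun ξ => ENNReal.ofReal (Real.exp (l * f ξ y)) :=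
      (Real.measurable_exp.comp ((hfm.comp measurable_prodMk_right).const_mul l)).ennreal_ofReal
    rw [hg, lintegral_add_left hm1, two_mul, ENNReal.ofReal_add hM0.le hM0.le]
    refine add_le_add (lintegral_exp_noiseForm_le θ hη hy4 habs) ?_
    have h2 := lintegral_exp_noiseForm_le θ hη hy4 (l := -l) (by rwa [abs_neg])
    rwa [neg_sq] at h2
  -- On the event in question `G` is at least `vol (ball 0 (1/4)) * exp (l κ / 3)`.
  have hlower : ∀ ξ, (∃ y : Fin n → ℝ, κ * (y ⬝ᵥ y) <
      |noiseForm θ η (observation 1 θ η ξ) y|) →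
      ENNReal.ofReal (Real.exp (l * κ / 3)) * V ≤ G ξ := by
    rintro ξ ⟨x, hx⟩
    obtain ⟨v, hv1, hv⟩ := exists_ball_le_abs_quadForm
      (noiseMatrix_isSymm θ η (observation 1 θ η ξ)) hκ
      ⟨x, by rwa [dotProduct_noiseMatrix]⟩
    have hsub : Metric.ball v (1 / 4) ⊆ B := by
      apply Metric.ball_subset_ball'
      rw [dist_zero_right, hv1]
      norm_num
    have hVv : volume (Metric.ball v (1 / 4)) = V := Measure.addHaar_ball_center _ _ _
    rw [← hVv, ← setLIntegral_const]
    refine (setLIntegral_mono' measurableSet_ball fun y hy => ?_).trans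
      (lintegral_mono_set hsub)
    have h1 := hv y hy
    rw [dotProduct_noiseMatrix] at h1
    rcases le_abs.1 h1 with h2 | h2
    · refine le_add_right (ENNReal.ofReal_le_ofReal (Real.exp_le_exp.2 ?_))
      have := mul_le_mul_of_nonneg_left h2 hl0
      linarith
    · refine le_add_left (ENNReal.ofReal_le_ofReal (Real.exp_le_exp.2 ?_))
      have := mul_le_mul_of_nonneg_left h2 hl0
      simp only [hf]
      linarith
  have hmarkov := mul_meas_ge_le_lintegral (μ := noiseLaw n p) hGm
    (ENNReal.ofReal (Real.exp (l * κ / 3)) * V)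
  have hle : ENNReal.ofReal (Real.exp (l * κ / 3)) * V * noiseLaw n p {ξ | ∃ y : Fin n → ℝ,
        κ * (y ⬝ᵥ y) < |noiseForm θ η (observation 1 θ η ξ) y|} ≤
      ENNReal.ofReal (2 * M) * (ENNReal.ofReal (8 ^ n) * V) := by
    rw [← hBV]
    refine le_trans (mul_le_mul_right (measure_mono fun ξ hξ => ?_) _) (hmarkov.trans hupper)
    exact hlower ξ hξ
  have hle2 : ENNReal.ofReal (Real.exp (l * κ / 3)) * noiseLaw n p {ξ | ∃ y : Fin n → ℝ,
        κ * (y ⬝ᵥ y) < |noiseForm θ η (observation 1 θ η ξ) y|} ≤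
      ENNReal.ofReal (2 * M * 8 ^ n) := by
    rw [ENNReal.ofReal_mul (by positivity)]
    rw [← mul_assoc, mul_right_comm] at hle
    exact (ENNReal.mul_le_mul_iff_left hV0 hVt).1 hle
  have hexp : 2 * 8 ^ n * Real.exp (64 * l ^ 2 * (p + n * ‖θ‖ ^ 2) - l * κ / 3) =
      2 * M * 8 ^ n / Real.exp (l * κ / 3) := by
    rw [Real.exp_sub]; ring
  rw [hexp, ENNReal.ofReal_div_of_pos (Real.exp_pos _),
    ENNReal.le_div_iff_mul_le (Or.inl (by simp [Real.exp_pos])) (Or.inl ENNReal.ofReal_ne_top),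
    mul_comm]
  exact hle2

/-- The previous bound at its optimal exponent, at the level `τ n ‖θ‖² / 4`. -/
theorem measure_noiseForm_gt_le_exp {n p : ℕ} (hn : 1 ≤ n) (θ : EuclideanSpace ℝ (Fin p))
    (hθ : 0 < ‖θ‖) {η : Fin n → ℝ} (hη : IsLabel η) {τ : ℝ} (hτ0 : 0 ≤ τ) (hτ1 : τ ≤ 1) :
    noiseLaw n p {ξ | ∃ y : Fin n → ℝ, τ * n * ‖θ‖ ^ 2 / 4 * (y ⬝ᵥ y) <
        |noiseForm θ η (observation 1 θ η ξ) y|} ≤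
      ENNReal.ofReal (Real.exp (3 * n - τ ^ 2 * n * snrSq n p ‖θ‖ / 36864)) := by
  have hn0 : (0 : ℝ) < n := by exact_mod_cast hn
  have hn1 : (1 : ℝ) ≤ n := by exact_mod_cast hn
  set D : ℝ := p + n * ‖θ‖ ^ 2 with hD
  have hD0 : 0 < D := by positivity
  set κ := τ * n * ‖θ‖ ^ 2 / 4 with hκ
  have hκ0 : 0 ≤ κ := by positivity
  have hκD : κ ≤ D := by
    have h1 : 0 ≤ (p : ℝ) := Nat.cast_nonneg p
    have h2 : τ * (n * ‖θ‖ ^ 2) ≤ n * ‖θ‖ ^ 2 := mul_le_of_le_one_left (by positivity) hτ1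
    have h3 : 0 ≤ (n : ℝ) * ‖θ‖ ^ 2 := by positivity
    rw [hκ, hD]
    linarith
  have hl : κ / (384 * D) ≤ 1 / 16 := by
    rw [div_le_div_iff₀ (by positivity) (by norm_num)]
    linarith
  refine (measure_noiseForm_gt_le θ hη hκ0 (by positivity) hl).trans
    (ENNReal.ofReal_le_ofReal ?_)
  have h8 : (2 : ℝ) * 8 ^ n ≤ Real.exp (3 * n) := by
    have h1 : (16 : ℝ) ≤ Real.exp 3 := by
      have h := Real.exp_one_gt_d9
      have : Real.exp 3 = Real.exp 1 ^ 3 := by rw [← Real.exp_nat_mul]; norm_num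
      rw [this]
      calc (16 : ℝ) ≤ 2.7 ^ 3 := by norm_num
        _ ≤ Real.exp 1 ^ 3 := by gcongr; linarith
    calc (2 : ℝ) * 8 ^ n ≤ 2 ^ n * 8 ^ n := by
          gcongr
          exact le_self_pow₀ (by norm_num) (by omega)
      _ = 16 ^ n := by rw [← mul_pow]; norm_num
      _ ≤ Real.exp 3 ^ n := by gcongr
      _ = Real.exp (3 * n) := by rw [← Real.exp_nat_mul, mul_comm]
  have hexp : 64 * (κ / (384 * D)) ^ 2 * D - κ / (384 * D) * κ / 3 =
      -(τ ^ 2 * n * snrSq n p ‖θ‖ / 36864) := by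
    have hr : snrSq n p ‖θ‖ = n * ‖θ‖ ^ 4 / D := by
      rw [snrSq, hD]
      have : ‖θ‖ ^ 2 + (p : ℝ) / n = (p + n * ‖θ‖ ^ 2) / n := by field_simp; ring
      rw [this]
      field_simp
    rw [hr, hκ]
    field_simp
    ring
  rw [hexp, sub_eq_add_neg, Real.exp_add]
  exact mul_le_mul_of_nonneg_right h8 (Real.exp_pos _).le

/-! ### Deterministic analysis of the spectral initialization and of the iteration -/

theorem hollowGram_isSymm {n p : ℕ} (Y : Matrix (Fin p) (Fin n) ℝ) : (hollowGram Y).IsSymm := by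
  unfold hollowGram hollow Matrix.IsSymm
  simp [Matrix.transpose_mul]

theorem hollowGram_sub_signal {n p : ℕ} (θ : EuclideanSpace ℝ (Fin p)) {η : Fin n → ℝ}
    (hη : IsLabel η) (Y : Matrix (Fin p) (Fin n) ℝ) :
    hollowGram Y - ‖θ‖ ^ 2 • Matrix.vecMulVec η η =
      noiseMatrix θ η Y - Matrix.diagonal (noiseMatrix θ η Y).diag - ‖θ‖ ^ 2 • 1 := by
  ext i j
  rcases eq_or_ne i j with rfl | hij
  · have := hη.sq_eq_one i
    simp [hollowGram, hollow, noiseMatrix, Matrix.vecMulVec_apply, ← sq, this]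
  · simp [hollowGram, hollow, noiseMatrix, Matrix.vecMulVec_apply, hij]

/-- Hollowing at most doubles the size of the noise, since the diagonal entries are themselves
values of the quadratic form; it also removes the diagonal `‖θ‖²` of the signal. -/
theorem abs_quadForm_hollowGram_le {n p : ℕ} (θ : EuclideanSpace ℝ (Fin p)) {η : Fin n → ℝ}
    (hη : IsLabel η) {Y : Matrix (Fin p) (Fin n) ℝ} {κ : ℝ}
    (h : ∀ y : Fin n → ℝ, |noiseForm θ η Y y| ≤ κ * (y ⬝ᵥ y)) (y : Fin n → ℝ) :
    |y ⬝ᵥ (hollowGram Y - ‖θ‖ ^ 2 • Matrix.vecMulVec η η).mulVec y| ≤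
      (2 * κ + ‖θ‖ ^ 2) * (y ⬝ᵥ y) := by
  rw [hollowGram_sub_signal θ hη, Matrix.sub_mulVec, Matrix.sub_mulVec, dotProduct_sub,
    dotProduct_sub, dotProduct_noiseMatrix, Matrix.smul_mulVec, Matrix.one_mulVec,
    dotProduct_smul, smul_eq_mul]
  have hdiag : ∀ i, |(noiseMatrix θ η Y).diag i| ≤ κ := by
    intro i
    have h1 := h (Pi.single i 1)
    rw [← dotProduct_noiseMatrix] at h1
    simpa using h1
  have h2 : |y ⬝ᵥ (Matrix.diagonal (noiseMatrix θ η Y).diag).mulVec y| ≤ κ * (y ⬝ᵥ y) := by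
    simp only [dotProduct, Matrix.mulVec_diagonal, Finset.mul_sum]
    refine (Finset.abs_sum_le_sum_abs _ _).trans (Finset.sum_le_sum fun i _ => ?_)
    have h3 : y i * ((noiseMatrix θ η Y).diag i * y i) =
        (noiseMatrix θ η Y).diag i * (y i * y i) := by ring
    rw [h3, abs_mul, abs_of_nonneg (mul_self_nonneg (y i))]
    exact mul_le_mul_of_nonneg_right (hdiag i) (mul_self_nonneg _)
  have h1 := h y
  have h4 : 0 ≤ ‖θ‖ ^ 2 * (y ⬝ᵥ y) :=
    mul_nonneg (sq_nonneg _) (Finset.sum_nonneg fun i _ => mul_self_nonneg _)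
  rw [abs_le] at h1 h2 ⊢
  constructor <;> linarith [h1.1, h1.2, h2.1, h2.2]

/-- Every Rayleigh quotient is at most the largest eigenvalue. -/
theorem quadForm_le_of_isTopEigenvector {n : ℕ} {M : Matrix (Fin n) (Fin n) ℝ} (hM : M.IsSymm)
    {l : ℝ} (hl : ∀ m : ℝ, Module.End.HasEigenvalue (Matrix.toLin' M) m → m ≤ l)
    (x : Fin n → ℝ) : x ⬝ᵥ M.mulVec x ≤ l * (x ⬝ᵥ x) := by
  have hH : (l • (1 : Matrix (Fin n) (Fin n) ℝ) - M).IsHermitian := by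
    rw [Matrix.IsHermitian, Matrix.conjTranspose_eq_transpose_of_trivial]
    simp [hM.eq]
  have hpsd : (l • (1 : Matrix (Fin n) (Fin n) ℝ) - M).PosSemidef := by
    rw [hH.posSemidef_iff_eigenvalues_nonneg]
    intro i
    have h1 := hH.mulVec_eigenvectorBasis i
    set w : Fin n → ℝ := (hH.eigenvectorBasis i).ofLp with hw
    rw [Matrix.sub_mulVec, Matrix.smul_mulVec, Matrix.one_mulVec] at h1
    have h2 : M.mulVec w = (l - hH.eigenvalues i) • w := by
      rw [sub_smul, ← h1]; abel
    have hw0 : w ≠ 0 := by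
      intro h0
      apply hH.eigenvectorBasis.orthonormal.ne_zero i
      ext j
      exact congrFun h0 j
    have h3 := hl _ (Module.End.hasEigenvalue_of_hasEigenvector (x := w)
      ⟨Module.End.mem_eigenspace_iff.2 (by rw [Matrix.toLin'_apply, h2]), hw0⟩)
    change 0 ≤ hH.eigenvalues i
    linarith
  have h4 := hpsd.dotProduct_mulVec_nonneg x
  rw [star_trivial, Matrix.sub_mulVec, Matrix.smul_mulVec, Matrix.one_mulVec, dotProduct_sub,
    dotProduct_smul, smul_eq_mul] at h4
  linarith

open Classical in
/-- The set of the coordinates in which `u` and `η` disagree. -/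
noncomputable def mistakes {n : ℕ} (u η : Fin n → ℝ) : Finset (Fin n) :=
  Finset.univ.filter fun i => u i ≠ η i

theorem isLabel_signVec {n : ℕ} (v : Fin n → ℝ) : IsLabel (signVec v) := by
  intro i
  unfold signVec
  split_ifs <;> simp

/-- A wrong sign means a nonpositive product; equality can occur since `sign 0 = 1`. -/
theorem mul_nonpos_of_signVec_ne {n : ℕ} {v η : Fin n → ℝ} (hη : IsLabel η) {i : Fin n}
    (h : signVec v i ≠ η i) : η i * v i ≤ 0 := by
  unfold signVec at h
  rcases hη i with h1 | h1 <;> rw [h1] at h ⊢ <;> split_ifs at h with h2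
  · exact absurd rfl h
  · linarith
  · linarith
  · exact absurd rfl h

theorem IsLabel.neg {n : ℕ} {η : Fin n → ℝ} (hη : IsLabel η) : IsLabel (-η) := by
  intro i
  rcases hη i with h | h <;> simp [h]

theorem IsLabel.dotProduct_self {n : ℕ} {η : Fin n → ℝ} (hη : IsLabel η) : η ⬝ᵥ η = n := by
  simp [dotProduct, ← sq, hη.sq_eq_one]

theorem dotProduct_signal {n : ℕ} (b : ℝ) (η x : Fin n → ℝ) :
    x ⬝ᵥ (b • Matrix.vecMulVec η η).mulVec x = b * (η ⬝ᵥ x) ^ 2 := by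
  rw [Matrix.smul_mulVec, Matrix.vecMulVec_mulVec, dotProduct_smul, dotProduct_smul,
    dotProduct_comm x η]
  simp [sq]

/-- If `v` correlates with `η`, then few signs of `v` are wrong: the wrong coordinates contribute
nonpositively to `η ⬝ᵥ v`, so Cauchy–Schwarz applies on the remaining ones. -/
theorem card_mistakes_signVec_le {n : ℕ} {η v : Fin n → ℝ} (hη : IsLabel η) {a : ℝ}
    (hv0 : 0 < v ⬝ᵥ v) (hpos : 0 ≤ η ⬝ᵥ v) (h : (n - a) * (v ⬝ᵥ v) ≤ (η ⬝ᵥ v) ^ 2) :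
    ((mistakes (signVec v) η).card : ℝ) ≤ a := by
  classical
  set S := mistakes (signVec v) η with hS
  have h1 : η ⬝ᵥ v ≤ ∑ i ∈ Sᶜ, η i * v i := by
    rw [dotProduct, ← Finset.sum_add_sum_compl S]
    have : ∑ i ∈ S, η i * v i ≤ 0 := Finset.sum_nonpos fun i hi =>
      mul_nonpos_of_signVec_ne hη (by simpa [hS, mistakes] using hi)
    linarith
  have h2 : (∑ i ∈ Sᶜ, η i * v i) ^ 2 ≤ ((n : ℝ) - S.card) * (v ⬝ᵥ v) := by
    refine (Finset.sum_mul_sq_le_sq_mul_sq _ _ _).trans ?_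
    simp only [hη.sq_eq_one, Finset.sum_const, nsmul_eq_mul, mul_one]
    have hc : ((Sᶜ.card : ℕ) : ℝ) = n - S.card := by
      rw [Finset.card_compl, Fintype.card_fin, Nat.cast_sub]
      simpa using Finset.card_le_univ S
    rw [hc]
    have hn : (0 : ℝ) ≤ n - S.card := by rw [← hc]; positivity
    apply mul_le_mul_of_nonneg_left _ hn
    rw [dotProduct]
    simp_rw [← sq]
    exact Finset.sum_le_sum_of_subset_of_nonneg (Finset.subset_univ _)
      fun _ _ _ => sq_nonneg _
  have h3 : (η ⬝ᵥ v) ^ 2 ≤ (∑ i ∈ Sᶜ, η i * v i) ^ 2 := by gcongr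
  have h4 : ((n : ℝ) - a) * (v ⬝ᵥ v) ≤ (n - S.card) * (v ⬝ᵥ v) := h.trans (h3.trans h2)
  have := le_of_mul_le_mul_right h4 hv0
  linarith

/-- The spectral initialization is correct up to a small fraction of the labels. -/
theorem card_mistakes_of_isTopEigenvector {n : ℕ} (hn : 1 ≤ n) {M : Matrix (Fin n) (Fin n) ℝ}
    (hM : M.IsSymm) {b τ : ℝ} (hb : 0 < b) {η v : Fin n → ℝ} (hη : IsLabel η)
    (hE : ∀ x : Fin n → ℝ, |x ⬝ᵥ (M - b • Matrix.vecMulVec η η).mulVec x| ≤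
      τ * n * b * (x ⬝ᵥ x)) (hv : IsTopEigenvector M v) :
    ((mistakes (signVec v) η).card : ℝ) ≤ 2 * τ * n ∨
      ((mistakes (signVec v) (-η)).card : ℝ) ≤ 2 * τ * n := by
  obtain ⟨l, hev, hl⟩ := hv
  have hn0 : (0 : ℝ) < n := by exact_mod_cast hn
  have hvM : M.mulVec v = l • v := by
    have := hev.apply_eq_smul
    rwa [Matrix.toLin'_apply] at this
  have hv0 : 0 < v ⬝ᵥ v := by
    rcases (Finset.sum_nonneg fun i _ => mul_self_nonneg (v i) :
      0 ≤ v ⬝ᵥ v).lt_or_eq with h | h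
    · exact h
    · exact absurd (dotProduct_self_eq_zero.1 h.symm) hev.2
  have e1 := quadForm_le_of_isTopEigenvector hM hl η
  have e2 := hE η
  have e3 := hE v
  rw [Matrix.sub_mulVec, dotProduct_sub, dotProduct_signal, hη.dotProduct_self] at e2
  rw [Matrix.sub_mulVec, dotProduct_sub, dotProduct_signal, hvM, dotProduct_smul,
    smul_eq_mul] at e3
  rw [hη.dotProduct_self] at e1
  have h1 := (abs_le.1 e2).1
  have h2 := (abs_le.1 e3).2
  have hl1 : b * n - τ * n * b ≤ l := by
    have : (b * n - τ * n * b) * n ≤ l * n := by linarith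
    exact le_of_mul_le_mul_right this hn0
  have h3 : (n - 2 * τ * n) * (v ⬝ᵥ v) ≤ (η ⬝ᵥ v) ^ 2 := by
    have h4 := mul_le_mul_of_nonneg_right hl1 hv0.le
    have h5 : b * ((n - 2 * τ * n) * (v ⬝ᵥ v)) ≤ b * (η ⬝ᵥ v) ^ 2 := by linarith
    exact le_of_mul_le_mul_left h5 hb
  rcases le_total 0 (η ⬝ᵥ v) with h | h
  · exact Or.inl (card_mistakes_signVec_le hη hv0 h h3)
  · refine Or.inr (card_mistakes_signVec_le hη.neg hv0 (by rw [neg_dotProduct]; linarith) ?_)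
    rwa [neg_dotProduct, neg_sq]

theorem hamming_eq_two_mul_card {n : ℕ} {u η : Fin n → ℝ} (hu : IsLabel u) (hη : IsLabel η) :
    hamming u η = 2 * (mistakes u η).card := by
  classical
  rw [hamming, mistakes, Finset.card_filter, Nat.cast_sum, Finset.mul_sum]
  refine Finset.sum_congr rfl fun i _ => ?_
  rcases hu i with h | h <;> rcases hη i with h' | h' <;> rw [h, h'] <;> norm_num

theorem loss_le_card {n : ℕ} {u η : Fin n → ℝ} (hu : IsLabel u) (hη : IsLabel η) :
    loss u η ≤ n := by
  have h : hamming u η + hamming u (-η) = 2 * n := by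
    rw [hamming, hamming, ← Finset.sum_add_distrib]
    have : ∀ i, |u i - η i| + |u i - (-η) i| = 2 := by
      intro i
      rcases hu i with h | h <;> rcases hη i with h' | h' <;> rw [Pi.neg_apply, h, h'] <;> norm_num
    rw [Finset.sum_congr rfl fun i _ => this i]
    simp [mul_comm]
  rw [loss]
  rcases le_total (hamming u η) (hamming u (-η)) with h' | h'
  · exact (min_le_left _ _).trans (by linarith)
  · exact (min_le_right _ _).trans (by linarith)

theorem mulVec_dotProduct_self_le {n : ℕ} {A : Matrix (Fin n) (Fin n) ℝ} (hA : A.IsSymm) {κ : ℝ}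
    (hκ : 0 < κ) (h : ∀ x : Fin n → ℝ, |x ⬝ᵥ A.mulVec x| ≤ κ * (x ⬝ᵥ x)) (x : Fin n → ℝ) :
    A.mulVec x ⬝ᵥ A.mulVec x ≤ κ ^ 2 * (x ⬝ᵥ x) := by
  have h1 := abs_bilin_le hA h (A.mulVec x) (κ • x)
  have h2 := le_abs_self (A.mulVec x ⬝ᵥ A.mulVec (κ • x))
  rw [Matrix.mulVec_smul, dotProduct_smul, smul_eq_mul] at h1 h2
  rw [smul_dotProduct, dotProduct_smul, smul_eq_mul, smul_eq_mul] at h1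
  have h3 : κ * (A.mulVec x ⬝ᵥ A.mulVec x) ≤ κ * (κ ^ 2 * (x ⬝ᵥ x)) := by linarith
  exact le_of_mul_le_mul_left h3 hκ

open Classical in
/-- The samples whose margin is at most `c`. -/
noncomputable def lowMargin {n : ℕ} (M : Matrix (Fin n) (Fin n) ℝ) (η : Fin n → ℝ) (c : ℝ) :
    Finset (Fin n) :=
  Finset.univ.filter fun i => η i * M.mulVec η i ≤ c

/-- One step of the iteration divides the number of mistakes by 16, up to the samples of small
margin. A sample of large margin can only be misclassified if the noise applied to the current
error vector is large there, and the operator norm of the noise limits how often this happens. -/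
theorem card_mistakes_step {n : ℕ} (hn : 1 ≤ n) {M : Matrix (Fin n) (Fin n) ℝ} (hM : M.IsSymm)
    {b τ : ℝ} (hb : 0 < b) (hτ : 0 < τ) {η u : Fin n → ℝ} (hη : IsLabel η) (hu : IsLabel u)
    (hE : ∀ x : Fin n → ℝ, |x ⬝ᵥ (M - b • Matrix.vecMulVec η η).mulVec x| ≤
      τ * n * b * (x ⬝ᵥ x))
    (hm : ((mistakes u η).card : ℝ) ≤ 4 * τ * n) :
    ((mistakes (signVec (M.mulVec u)) η).card : ℝ) ≤
      (lowMargin M η (16 * τ * n * b)).card + (mistakes u η).card / 16 := by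
  classical
  have hn0 : (0 : ℝ) < n := by exact_mod_cast hn
  set m : ℝ := ((mistakes u η).card : ℝ) with hmdef
  set E := M - b • Matrix.vecMulVec η η with hEdef
  have hEs : E.IsSymm := by
    rw [hEdef, Matrix.IsSymm, Matrix.transpose_sub, Matrix.transpose_smul, hM.eq,
      Matrix.transpose_vecMulVec]
  set κ := τ * n * b with hκ
  have hκ0 : 0 < κ := by positivity
  set d := u - η with hd
  have hterm : ∀ i, d i * d i = 4 * (if u i ≠ η i then 1 else 0) ∧
      η i * d i = -2 * (if u i ≠ η i then 1 else 0) := by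
    intro i
    rw [hd, Pi.sub_apply]
    rcases hu i with h | h <;> rcases hη i with h' | h' <;> rw [h, h'] <;> norm_num
  have hcard : m = ∑ i, (if u i ≠ η i then (1 : ℝ) else 0) := by
    rw [hmdef, mistakes, Finset.card_filter, Nat.cast_sum]
    exact Finset.sum_congr rfl fun i _ => by split_ifs <;> simp
  have hdd : d ⬝ᵥ d = 4 * m := by
    rw [hcard, dotProduct, Finset.mul_sum]
    exact Finset.sum_congr rfl fun i _ => (hterm i).1
  have hηd : η ⬝ᵥ d = -2 * m := by
    rw [hcard, dotProduct, Finset.mul_sum]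
    exact Finset.sum_congr rfl fun i _ => (hterm i).2
  set T : Finset (Fin n) := Finset.univ.filter fun i => (8 * κ) ^ 2 ≤ (E.mulVec d i) ^ 2 with hT
  have hsub : mistakes (signVec (M.mulVec u)) η ⊆ lowMargin M η (16 * τ * n * b) ∪ T := by
    intro i hi
    have h1 : η i * M.mulVec u i ≤ 0 :=
      mul_nonpos_of_signVec_ne hη (by simpa [mistakes] using hi)
    have h2 : M.mulVec u i = M.mulVec η i + b * (η i * (η ⬝ᵥ d)) + E.mulVec d i := by
      have : u = η + d := by rw [hd]; abel
      conv_lhs => rw [this]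
      have hMd : M.mulVec d = (b • Matrix.vecMulVec η η).mulVec d + E.mulVec d := by
        rw [hEdef, Matrix.sub_mulVec]; abel
      rw [Matrix.mulVec_add, hMd, Matrix.smul_mulVec, Matrix.vecMulVec_mulVec]
      simp only [Pi.add_apply, Pi.smul_apply, smul_eq_mul, MulOpposite.smul_eq_mul_unop,
        MulOpposite.unop_op]
      ring
    rw [Finset.mem_union]
    by_contra hcon
    rw [not_or] at hcon
    obtain ⟨h3, h4⟩ := hcon
    simp only [lowMargin, Finset.mem_filter, Finset.mem_univ, true_and, not_le] at h3
    simp only [hT, Finset.mem_filter, Finset.mem_univ, true_and, not_le] at h4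
    have h5 : |E.mulVec d i| < 8 * κ := abs_lt_of_sq_lt_sq h4 (by positivity)
    have h6 : |η i * E.mulVec d i| < 8 * κ := by
      rw [abs_mul]
      rcases hη i with h | h <;> rw [h] <;> simpa using h5
    have h7 := (abs_lt.1 h6).1
    rw [h2, hηd] at h1
    have h8 : η i * (M.mulVec η i + b * (η i * (-2 * m)) + E.mulVec d i) =
        η i * M.mulVec η i - 2 * m * b + η i * E.mulVec d i := by
      linear_combination (-2 * m * b) * hη.sq_eq_one i
    rw [h8] at h1
    have h9 : 2 * m * b ≤ 8 * κ := by
      rw [hκ]; nlinarith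
    rw [hκ] at h7 h9
    linarith
  have hTcard : (T.card : ℝ) ≤ m / 16 := by
    have h1 : (T.card : ℝ) * (8 * κ) ^ 2 ≤ E.mulVec d ⬝ᵥ E.mulVec d := by
      rw [← nsmul_eq_mul, ← Finset.sum_const, dotProduct]
      refine (Finset.sum_le_sum fun i hi => ?_).trans
        (Finset.sum_le_sum_of_subset_of_nonneg (Finset.subset_univ T)
          fun _ _ _ => mul_self_nonneg _)
      rw [← sq]
      simpa [hT] using hi
    have h2 := mulVec_dotProduct_self_le hEs hκ0 hE d
    rw [hdd] at h2
    have h3 : (T.card : ℝ) * 16 * (4 * κ ^ 2) ≤ m * (4 * κ ^ 2) := by linarith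
    have := le_of_mul_le_mul_right h3 (by positivity)
    linarith
  have h1 : ((mistakes (signVec (M.mulVec u)) η).card : ℝ) ≤
      (lowMargin M η (16 * τ * n * b)).card + T.card := by
    exact_mod_cast (Finset.card_le_card hsub).trans (Finset.card_union_le _ _)
  linarith

/-- After `⌊3 log n⌋` steps, a contraction by 16 has brought `n` below one. -/
theorem card_lt_sixteen_pow {n : ℕ} (hn : 2 ≤ n) : (n : ℝ) < 16 ^ ⌊3 * Real.log n⌋₊ := by
  set K := ⌊3 * Real.log n⌋₊ with hK
  have hn2 : (2 : ℝ) ≤ n := by exact_mod_cast hn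
  have hlog : 0.6 < Real.log n :=
    lt_of_lt_of_le (by linarith [Real.log_two_gt_d9]) (Real.log_le_log (by norm_num) hn2)
  have h1 : 3 * Real.log n < K + 1 := Nat.lt_floor_add_one _
  have h2 : (n : ℝ) = Real.exp (Real.log n) := (Real.exp_log (by linarith)).symm
  have h3 : Real.exp 2 ≤ 16 := by
    have h := Real.exp_one_lt_d9
    have : Real.exp 2 = Real.exp 1 ^ 2 := by rw [← Real.exp_nat_mul]; norm_num
    rw [this]
    nlinarith [Real.exp_pos 1]
  calc (n : ℝ) = Real.exp (Real.log n) := h2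
    _ < Real.exp (K * 2) := Real.exp_lt_exp.2 (by linarith)
    _ = Real.exp 2 ^ K := Real.exp_nat_mul _ _
    _ ≤ 16 ^ K := by gcongr

theorem card_mistakes_iterate {n : ℕ} (hn : 2 ≤ n) {M : Matrix (Fin n) (Fin n) ℝ} (hM : M.IsSymm)
    {b τ : ℝ} (hb : 0 < b) (hτ : 0 < τ) {η : Fin n → ℝ} (hη : IsLabel η)
    (hE : ∀ x : Fin n → ℝ, |x ⬝ᵥ (M - b • Matrix.vecMulVec η η).mulVec x| ≤
      τ * n * b * (x ⬝ᵥ x)) {u : ℕ → Fin n → ℝ} (hu0 : IsLabel (u 0))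
    (hu : ∀ k, u (k + 1) = signVec (M.mulVec (u k)))
    (h0 : ((mistakes (u 0) η).card : ℝ) ≤ 2 * τ * n)
    (hN : ((lowMargin M η (16 * τ * n * b)).card : ℝ) ≤ 2 * τ * n) :
    (mistakes (u ⌊3 * Real.log n⌋₊) η).card ≤ 2 * (lowMargin M η (16 * τ * n * b)).card := by
  have hn0 : (0 : ℝ) < n := by positivity
  set N : ℝ := ((lowMargin M η (16 * τ * n * b)).card : ℝ) with hNdef
  have hN0 : 0 ≤ N := Nat.cast_nonneg _
  have hτn : 0 < τ * n := by positivity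
  have hlab : ∀ k, IsLabel (u k) := by
    intro k
    cases k with
    | zero => exact hu0
    | succ k => rw [hu]; exact isLabel_signVec _
  have key : ∀ k, ((mistakes (u k) η).card : ℝ) ≤ 4 * τ * n ∧
      ((mistakes (u k) η).card : ℝ) ≤ n / 16 ^ k + 2 * N := by
    intro k
    induction k with
    | zero =>
      refine ⟨by linarith, ?_⟩
      have : (mistakes (u 0) η).card ≤ n := by simpa using Finset.card_le_univ (mistakes (u 0) η)
      have : ((mistakes (u 0) η).card : ℝ) ≤ n := by exact_mod_cast this
      rw [pow_zero, div_one]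
      linarith
    | succ k ih =>
      have h := card_mistakes_step (by omega) hM hb hτ hη (hlab k) hE ih.1
      rw [← hu k, ← hNdef] at h
      refine ⟨by linarith [ih.1], ?_⟩
      have e : (n : ℝ) / 16 ^ (k + 1) = n / 16 ^ k / 16 := by rw [pow_succ, div_div]
      rw [e]
      linarith [ih.2]
  have h1 := (key ⌊3 * Real.log n⌋₊).2
  have h2 : (n : ℝ) / 16 ^ ⌊3 * Real.log n⌋₊ < 1 := by
    rw [div_lt_one (by positivity)]
    exact card_lt_sixteen_pow hn
  have h3 : ((mistakes (u ⌊3 * Real.log n⌋₊) η).card : ℝ) <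
      ((2 * (lowMargin M η (16 * τ * n * b)).card + 1 : ℕ) : ℝ) := by
    push_cast
    rw [← hNdef]
    linarith
  have h4 : (mistakes (u ⌊3 * Real.log n⌋₊) η).card <
    2 * (lowMargin M η (16 * τ * n * b)).card + 1 := by exact_mod_cast h3
  omega

theorem lowMargin_neg {n : ℕ} (M : Matrix (Fin n) (Fin n) ℝ) (η : Fin n → ℝ) (c : ℝ) :
    lowMargin M (-η) c = lowMargin M η c := by
  unfold lowMargin
  congr 1
  ext i
  rw [Matrix.mulVec_neg, Pi.neg_apply, Pi.neg_apply, neg_mul_neg]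

/-- Deterministic guarantee: if the noise is smaller than the signal by a factor `τ`, then the
loss of the final iterate is controlled by the number of samples of small margin. -/
theorem loss_iterate_le {n : ℕ} (hn : 2 ≤ n) {M : Matrix (Fin n) (Fin n) ℝ} (hM : M.IsSymm)
    {b τ : ℝ} (hb : 0 < b) (hτ : 0 < τ) (hτ1 : τ ≤ 1 / 16) {η : Fin n → ℝ} (hη : IsLabel η)
    (hE : ∀ x : Fin n → ℝ, |x ⬝ᵥ (M - b • Matrix.vecMulVec η η).mulVec x| ≤
      τ * n * b * (x ⬝ᵥ x)) {u : ℕ → Fin n → ℝ} {v : Fin n → ℝ} (hv : IsTopEigenvector M v)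
    (hu0 : u 0 = signVec v) (hu : ∀ k, u (k + 1) = signVec (M.mulVec (u k))) :
    loss (u ⌊3 * Real.log n⌋₊) η ≤ (lowMargin M η (16 * τ * n * b)).card / (2 * τ) := by
  have hlab : ∀ k, IsLabel (u k) := by
    intro k
    cases k with
    | zero => rw [hu0]; exact isLabel_signVec _
    | succ k => rw [hu]; exact isLabel_signVec _
  set N := lowMargin M η (16 * τ * n * b) with hNdef
  rw [le_div_iff₀ (by positivity)]
  rcases le_or_gt (N.card : ℝ) (2 * τ * n) with hN | hN
  · have hgoal : ∀ m : ℕ, m ≤ 2 * N.card → 2 * (m : ℝ) * (2 * τ) ≤ N.card := by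
      intro m hm
      have h1 : (m : ℝ) ≤ 2 * N.card := by exact_mod_cast hm
      have h2 : 2 * (m : ℝ) * (2 * τ) ≤ 2 * (2 * N.card) * (2 * (1 / 16)) := by gcongr
      have h3 : (0 : ℝ) ≤ N.card := Nat.cast_nonneg _
      linarith
    rcases card_mistakes_of_isTopEigenvector (by omega) hM hb hη hE hv with h | h
    · have h1 := card_mistakes_iterate hn hM hb hτ hη hE (hlab 0) hu (by rwa [hu0]) hN
      refine le_trans ?_ (hgoal _ h1)
      rw [← hamming_eq_two_mul_card (hlab _) hη]
      gcongr
      exact min_le_left _ _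
    · have hvv : Matrix.vecMulVec (-η) (-η) = Matrix.vecMulVec η η := by
        ext i j; simp [Matrix.vecMulVec_apply]
      have h1 := card_mistakes_iterate hn hM hb hτ hη.neg (by rwa [hvv]) (hlab 0) hu
        (by rwa [hu0]) (by rwa [lowMargin_neg])
      rw [lowMargin_neg] at h1
      refine le_trans ?_ (hgoal _ h1)
      rw [← hamming_eq_two_mul_card (hlab _) hη.neg]
      gcongr
      exact min_le_right _ _
  · have h1 := loss_le_card (hlab ⌊3 * Real.log n⌋₊) hη
    have h2 := mul_le_mul_of_nonneg_right h1 (by positivity : 0 ≤ 2 * τ)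
    linarith

/-! ### The risk bound -/

theorem observation_eq_smul {n p : ℕ} {σ : ℝ} (hσ : 0 < σ) (θ : EuclideanSpace ℝ (Fin p))
    (η : Fin n → ℝ) (ξ : Fin n → Fin p → ℝ) :
    observation σ θ η ξ = σ • observation 1 (σ⁻¹ • θ) η ξ := by
  ext a i
  simp only [observation, Matrix.of_apply, Matrix.smul_apply, smul_eq_mul, PiLp.smul_apply]
  field_simp

theorem hollowGram_smul {n p : ℕ} (c : ℝ) (Y : Matrix (Fin p) (Fin n) ℝ) :
    hollowGram (c • Y) = c ^ 2 • hollowGram Y := by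
  ext i j
  rcases eq_or_ne i j with rfl | hij
  · simp [hollowGram, hollow]
  · simp [hollowGram, hollow, hij]
    ring

theorem measurable_observation {n p : ℕ} (σ : ℝ) (θ : EuclideanSpace ℝ (Fin p))
    (η : Fin n → ℝ) : Measurable (observation σ θ η) := by
  have : Measurable fun (ξ : Fin n → Fin p → ℝ) (a : Fin p) (i : Fin n) =>
      θ a * η i + σ * ξ i a := by fun_prop
  exact this

theorem measurable_margin_observation {n p : ℕ} (θ : EuclideanSpace ℝ (Fin p))
    {η : Fin n → ℝ} (hη : IsLabel η) (i : Fin n) :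
    Measurable fun ξ => margin η (observation 1 θ η ξ) i := by
  obtain ⟨m, rfl⟩ : ∃ m, n = m + 1 := ⟨n - 1, by have := i.pos; omega⟩
  simp_rw [margin_observation θ hη]
  fun_prop

theorem isLabel_lloyd {n p : ℕ} {η₀ : Matrix (Fin p) (Fin n) ℝ → Fin n → ℝ}
    (h : IsSpectralEstimator η₀) (k : ℕ) (Y : Matrix (Fin p) (Fin n) ℝ) :
    IsLabel (lloyd η₀ k Y) := by
  cases k with
  | zero =>
    obtain ⟨v, -, hv⟩ := h.2 Y
    rw [lloyd, hv]
    exact isLabel_signVec v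
  | succ k => exact isLabel_signVec _

/-- The loss is at most `n` if the noise matrix is too large, and is otherwise controlled by the
number of samples of small margin. -/
theorem lintegral_loss_le {n p : ℕ} (hn : 2 ≤ n) {σ : ℝ} (hσ : 0 < σ)
    (θ : EuclideanSpace ℝ (Fin p)) (hθ : 0 < ‖θ‖) {η : Fin n → ℝ} (hη : IsLabel η) {τ : ℝ}
    (hτ0 : 0 < τ) (hτ1 : τ ≤ 1 / 16) (hτn : 2 ≤ τ * n)
    {η₀ : Matrix (Fin p) (Fin n) ℝ → Fin n → ℝ} (h₀ : IsSpectralEstimator η₀) :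
    ∫⁻ Y, ENNReal.ofReal (loss (lloyd η₀ ⌊3 * Real.log n⌋₊ Y) η) ∂(law σ θ η) ≤
      n * ENNReal.ofReal (Real.exp (3 * n - τ ^ 2 * n * snrSq n p (‖θ‖ / σ) / 36864) +
        1 / (2 * τ) * Real.exp (-(snrSq n p (‖θ‖ / σ)) / 2 + 3 * snrSq n p (‖θ‖ / σ) / n +
          16 * τ * snrSq n p (‖θ‖ / σ))) := by
  classical
  set θ' := σ⁻¹ • θ with hθ'
  have hnorm : ‖θ'‖ = ‖θ‖ / σ := by
    rw [hθ', norm_smul, Real.norm_of_nonneg (by positivity), div_eq_inv_mul]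
  have hθ'0 : 0 < ‖θ'‖ := by rw [hnorm]; positivity
  rw [← hnorm]
  set Bad : Set (Fin n → Fin p → ℝ) := {ξ | ∃ y : Fin n → ℝ,
    τ * n * ‖θ'‖ ^ 2 / 4 * (y ⬝ᵥ y) < |noiseForm θ' η (observation 1 θ' η ξ) y|} with hBad
  set Low : Fin n → Set (Fin n → Fin p → ℝ) := fun i =>
    {ξ | margin η (observation 1 θ' η ξ) i ≤ 16 * τ * n * ‖θ'‖ ^ 2} with hLow
  have hLowm : ∀ i, MeasurableSet (Low i) := fun i =>
    measurableSet_le (measurable_margin_observation θ' hη i) measurable_const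
  have hpt : ∀ ξ, ENNReal.ofReal
      (loss (lloyd η₀ ⌊3 * Real.log n⌋₊ (observation σ θ η ξ)) η) ≤
      Bad.indicator (fun _ => (n : ℝ≥0∞)) ξ +
        ∑ i, (Low i).indicator (fun _ => ENNReal.ofReal (1 / (2 * τ))) ξ := by
    intro ξ
    by_cases hξ : ξ ∈ Bad
    · rw [Set.indicator_of_mem hξ]
      refine le_add_right ?_
      rw [← ENNReal.ofReal_natCast]
      exact ENNReal.ofReal_le_ofReal (loss_le_card (isLabel_lloyd h₀ _ _) hη)
    · refine le_add_left ?_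
      have hnoise : ∀ y : Fin n → ℝ, |noiseForm θ' η (observation 1 θ' η ξ) y| ≤
          τ * n * ‖θ'‖ ^ 2 / 4 * (y ⬝ᵥ y) := by
        intro y
        by_contra hy
        exact hξ ⟨y, not_le.1 hy⟩
      set Y₁ := observation 1 θ' η ξ with hY₁
      have hM : hollowGram (observation σ θ η ξ) = σ ^ 2 • hollowGram Y₁ := by
        rw [observation_eq_smul hσ, hollowGram_smul]
      have hE : ∀ x : Fin n → ℝ, |x ⬝ᵥ (hollowGram (observation σ θ η ξ) -
          (σ ^ 2 * ‖θ'‖ ^ 2) • Matrix.vecMulVec η η).mulVec x| ≤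
          τ * n * (σ ^ 2 * ‖θ'‖ ^ 2) * (x ⬝ᵥ x) := by
        intro x
        have h1 := abs_quadForm_hollowGram_le θ' hη hnoise x
        rw [hM, mul_smul, ← smul_sub, Matrix.smul_mulVec, dotProduct_smul, smul_eq_mul, abs_mul,
          abs_of_pos (by positivity : 0 < σ ^ 2)]
        have hxx : 0 ≤ x ⬝ᵥ x := Finset.sum_nonneg fun i _ => mul_self_nonneg _
        have h2 : 2 * (τ * n * ‖θ'‖ ^ 2 / 4) + ‖θ'‖ ^ 2 ≤ τ * n * ‖θ'‖ ^ 2 := by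
          nlinarith [sq_nonneg ‖θ'‖]
        have h3 := h1.trans (mul_le_mul_of_nonneg_right h2 hxx)
        calc _ ≤ σ ^ 2 * (τ * n * ‖θ'‖ ^ 2 * (x ⬝ᵥ x)) :=
              mul_le_mul_of_nonneg_left h3 (sq_nonneg σ)
          _ = _ := by ring
      obtain ⟨v, hv, hv0⟩ := h₀.2 (observation σ θ η ξ)
      have hloss := loss_iterate_le hn (hollowGram_isSymm _) (by positivity) hτ0 hτ1 hη hE
        (u := fun k => lloyd η₀ k (observation σ θ η ξ)) hv hv0 (fun k => rfl)
      have hcard : (((lowMargin (hollowGram (observation σ θ η ξ)) η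
          (16 * τ * n * (σ ^ 2 * ‖θ'‖ ^ 2))).card : ℕ) : ℝ≥0∞) =
          ∑ i, (Low i).indicator (fun _ => (1 : ℝ≥0∞)) ξ := by
        rw [lowMargin, Finset.card_filter, Nat.cast_sum]
        refine Finset.sum_congr rfl fun i _ => ?_
        have hiff : η i * (hollowGram (observation σ θ η ξ)).mulVec η i ≤
            16 * τ * n * (σ ^ 2 * ‖θ'‖ ^ 2) ↔ ξ ∈ Low i := by
          rw [hM, Matrix.smul_mulVec, Pi.smul_apply, smul_eq_mul]
          simp only [hLow, Set.mem_ofPred_eq, margin]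
          have e1 : η i * (σ ^ 2 * (hollowGram Y₁).mulVec η i) =
            σ ^ 2 * (η i * (hollowGram Y₁).mulVec η i) := by ring
          have e2 : 16 * τ * n * (σ ^ 2 * ‖θ'‖ ^ 2) = σ ^ 2 * (16 * τ * n * ‖θ'‖ ^ 2) := by ring
          rw [e1, e2]
          exact mul_le_mul_iff_right₀ (by positivity)
        by_cases hi : ξ ∈ Low i
        · rw [if_pos (hiff.2 hi), Set.indicator_of_mem hi, Nat.cast_one]
        · rw [if_neg (fun h => hi (hiff.1 h)), Set.indicator_of_notMem hi, Nat.cast_zero]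
      refine (ENNReal.ofReal_le_ofReal hloss).trans_eq ?_
      rw [div_eq_mul_one_div, ENNReal.ofReal_mul (Nat.cast_nonneg _), ENNReal.ofReal_natCast,
        hcard, Finset.sum_mul]
      refine Finset.sum_congr rfl fun i _ => ?_
      by_cases hi : ξ ∈ Low i
      · rw [Set.indicator_of_mem hi, Set.indicator_of_mem hi, one_mul]
      · rw [Set.indicator_of_notMem hi, Set.indicator_of_notMem hi, zero_mul]
  have hbad := measure_noiseForm_gt_le_exp (by omega : 1 ≤ n) θ' hθ'0 hη hτ0.le
    (by linarith : τ ≤ 1)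
  have hlow : ∀ i, noiseLaw n p (Low i) ≤ _ := fun i =>
    measure_margin_le hn θ' hθ'0 hη i (16 * τ)
  calc ∫⁻ Y, ENNReal.ofReal (loss (lloyd η₀ ⌊3 * Real.log n⌋₊ Y) η) ∂(law σ θ η)
      ≤ ∫⁻ ξ, ENNReal.ofReal
          (loss (lloyd η₀ ⌊3 * Real.log n⌋₊ (observation σ θ η ξ)) η) ∂(noiseLaw n p) :=
        lintegral_map_le _ (observation σ θ η)
    _ ≤ ∫⁻ ξ, (Bad.indicator (fun _ => (n : ℝ≥0∞)) ξ +
        ∑ i, (Low i).indicator (fun _ => ENNReal.ofReal (1 / (2 * τ))) ξ) ∂(noiseLaw n p) :=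
        lintegral_mono hpt
    _ = ∫⁻ ξ, Bad.indicator (fun _ => (n : ℝ≥0∞)) ξ ∂(noiseLaw n p) +
        ∑ i, ENNReal.ofReal (1 / (2 * τ)) * noiseLaw n p (Low i) := by
        rw [lintegral_add_right _ (Finset.measurable_sum _ fun i _ =>
          measurable_const.indicator (hLowm i)), lintegral_finsetSum _ fun i _ =>
          measurable_const.indicator (hLowm i)]
        simp_rw [lintegral_indicator_const (hLowm _)]
    _ ≤ n * noiseLaw n p Bad +
        ∑ i, ENNReal.ofReal (1 / (2 * τ)) * noiseLaw n p (Low i) :=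
        add_le_add_left (lintegral_indicator_const_le _ _) _
    _ ≤ n * _ + ∑ _i : Fin n, ENNReal.ofReal (1 / (2 * τ)) * _ :=
        add_le_add (mul_le_mul_right hbad _)
          (Finset.sum_le_sum fun i _ => mul_le_mul_right (hlow i) _)
    _ = _ := by
        rw [Finset.sum_const, Finset.card_univ, Fintype.card_fin, nsmul_eq_mul, ← mul_add,
          ← ENNReal.ofReal_mul (by positivity), ← ENNReal.ofReal_add (by positivity)
          (by positivity)]

/-- Elementary lower bound for the Gaussian tail, by the density on `(t, t + 1]`. -/
theorem gaussTail_ge {t : ℝ} (ht : 0 ≤ t) : Real.exp (-(t + 1) ^ 2 / 2) / 3 ≤ gaussTail t := by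
  have h3 : Real.sqrt (2 * Real.pi) ≤ 3 := by
    rw [Real.sqrt_le_left (by norm_num)]
    linarith [Real.pi_lt_d2]
  have hs0 : 0 < Real.sqrt (2 * Real.pi) := by positivity
  rw [gaussTail, measureReal_def, ← ENNReal.ofReal_le_iff_le_toReal (measure_ne_top _ _)]
  refine le_trans ?_ (measure_mono (Set.Ioc_subset_Ioi_self : Set.Ioc t (t + 1) ⊆ Set.Ioi t))
  rw [gaussianReal_apply 0 one_ne_zero]
  have hvol : volume (Set.Ioc t (t + 1)) = 1 := by simp
  calc ENNReal.ofReal (Real.exp (-(t + 1) ^ 2 / 2) / 3)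
      = ENNReal.ofReal (Real.exp (-(t + 1) ^ 2 / 2) / 3) * volume (Set.Ioc t (t + 1)) := by
        rw [hvol, mul_one]
    _ = ∫⁻ _ in Set.Ioc t (t + 1), ENNReal.ofReal (Real.exp (-(t + 1) ^ 2 / 2) / 3) := by
        rw [setLIntegral_const]
    _ ≤ ∫⁻ x in Set.Ioc t (t + 1), gaussianPDF 0 1 x := by
        refine setLIntegral_mono' measurableSet_Ioc fun x hx => ?_
        apply ENNReal.ofReal_le_ofReal
        rw [gaussianPDFReal_def, div_eq_inv_mul]
        simp only [NNReal.coe_one, mul_one, sub_zero]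
        apply mul_le_mul _ _ (Real.exp_pos _).le (by positivity)
        · gcongr
        · rw [Real.exp_le_exp]
          have : x ^ 2 ≤ (t + 1) ^ 2 := by
            have := hx.1
            exact pow_le_pow_left₀ (by linarith) hx.2 2
          linarith

theorem gaussTail_anti : Antitone gaussTail := by
  intro s t h
  exact measureReal_mono (Set.Ioi_subset_Ioi h)

theorem snr_sq {n p : ℕ} {σ Δ : ℝ} (hσ : 0 < σ) (hΔ : 0 < Δ) :
    snr n p σ Δ ^ 2 = snrSq n p (Δ / σ) := by
  have h : 0 ≤ Δ ^ 2 / σ ^ 2 + (p : ℝ) / n := by positivity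
  rw [snr, snrSq, div_pow _ (Real.sqrt _), Real.sq_sqrt h, div_pow Δ σ]
  ring

theorem snrSq_mono {n p : ℕ} {s t : ℝ} (hs : 0 < s) (h : s ≤ t) :
    snrSq n p s ≤ snrSq n p t := by
  unfold snrSq
  have hc : 0 ≤ (p : ℝ) / n := by positivity
  have h1 : s ^ 2 ≤ t ^ 2 := by gcongr
  have h2 : 0 < s ^ 2 := by positivity
  have ht : 0 < t := hs.trans_le h
  apply mul_le_mul h1 _ (by positivity) (by positivity)
  rw [div_le_div_iff₀ (by positivity) (by positivity)]
  nlinarith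

theorem worstCaseRisk_le_of_forall {n p : ℕ} {σ Δ : ℝ} {c : ℝ≥0∞} (hn : 1 ≤ n)
    {est : Matrix (Fin p) (Fin n) ℝ → Fin n → ℝ}
    (h : ∀ θ : EuclideanSpace ℝ (Fin p), Δ ≤ ‖θ‖ → ∀ η : Fin n → ℝ, IsLabel η →
      ∫⁻ Y, ENNReal.ofReal (loss (est Y) η) ∂(law σ θ η) ≤ n * c) :
    (n : ℝ≥0∞)⁻¹ * worstCaseRisk σ Δ est ≤ c := by
  have h1 : worstCaseRisk σ Δ est ≤ n * c :=
    iSup_le fun θ => iSup_le fun hθ => iSup_le fun η => iSup_le fun hη => h θ hθ η hη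
  refine (mul_le_mul_right h1 _).trans_eq ?_
  rw [← mul_assoc, ENNReal.inv_mul_cancel (by exact_mod_cast (by omega : n ≠ 0))
    (ENNReal.natCast_ne_top n), one_mul]

/-- With `τ = 500 / ρ + n^(-1/4)` both error probabilities are `exp (-ρ² / 2)`, up to factors
absorbed by the correction terms. Here `g = n^(1/4)`, and `R ≥ ρ²` is the squared signal-to-noise
ratio of the actual parameter. -/
theorem risk_exponents_le {ρ R g τ : ℝ} (hρ : 40000 ≤ ρ) (hR : ρ ^ 2 ≤ R) (hg : 1000 ≤ g)
    (hτ : τ = 500 / ρ + 1 / g) :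
    Real.exp (3 * g ^ 4 - τ ^ 2 * g ^ 4 * R / 36864) +
        1 / (2 * τ) * Real.exp (-R / 2 + 3 * R / g ^ 4 + 16 * τ * R) ≤
      2 * Real.exp (-ρ ^ 2 / 2 + 19 * ρ ^ 2 / g + 8001 * ρ) := by
  have hρ0 : 0 < ρ := by linarith
  have hg0 : 0 < g := by linarith
  have hR0 : 0 < R := lt_of_lt_of_le (by positivity) hR
  have hτ0 : 0 < τ := by rw [hτ]; positivity
  have hτρ : 500 ≤ τ * ρ := by
    have : τ * ρ = 500 + 1 / g * ρ := by rw [hτ]; field_simp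
    rw [this]
    have : 0 < 1 / g * ρ := by positivity
    linarith
  have hτg : 1 ≤ τ * g := by
    have : τ * g = 500 / ρ * g + 1 := by rw [hτ]; field_simp
    rw [this]
    have : 0 < 500 / ρ * g := by positivity
    linarith
  have hg2 : (1000 : ℝ) ^ 2 ≤ g ^ 2 := by gcongr
  have hgg : 1 / g ^ 4 ≤ 1 / g := by
    apply one_div_le_one_div_of_le hg0
    exact le_self_pow₀ (by linarith) (by norm_num)
  have hg1 : 1 / g ≤ 1 / 1000 := one_div_le_one_div_of_le (by norm_num) hg
  have hρ1 : 500 / ρ ≤ 1 / 80 := by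
    rw [div_le_div_iff₀ hρ0 (by norm_num)]; linarith
  have h1 : Real.exp (3 * g ^ 4 - τ ^ 2 * g ^ 4 * R / 36864) ≤
      Real.exp (-ρ ^ 2 / 2 + 19 * ρ ^ 2 / g + 8001 * ρ) := by
    rw [Real.exp_le_exp]
    have hg4 : 0 < g ^ 4 := by positivity
    have ha : 250000 ≤ τ ^ 2 * R := by
      calc (250000 : ℝ) = 500 ^ 2 := by norm_num
        _ ≤ (τ * ρ) ^ 2 := by gcongr
        _ = τ ^ 2 * ρ ^ 2 := by ring
        _ ≤ τ ^ 2 * R := by gcongr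
    have hb : 1000 ^ 2 ≤ τ ^ 2 * g ^ 4 := by
      calc (1000 : ℝ) ^ 2 ≤ 1 ^ 2 * g ^ 2 := by linarith
        _ ≤ (τ * g) ^ 2 * g ^ 2 := by gcongr
        _ = τ ^ 2 * g ^ 4 := by ring
    have hc : 250000 * g ^ 4 ≤ τ ^ 2 * R * g ^ 4 := by gcongr
    have hd : 1000 ^ 2 * R ≤ τ ^ 2 * g ^ 4 * R := by gcongr
    have he : 0 ≤ 19 * ρ ^ 2 / g + 8001 * ρ := by positivity
    linarith
  have h2 : 1 / (2 * τ) * Real.exp (-R / 2 + 3 * R / g ^ 4 + 16 * τ * R) ≤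
      Real.exp (-ρ ^ 2 / 2 + 19 * ρ ^ 2 / g + 8001 * ρ) := by
    have ha : 1 / (2 * τ) ≤ Real.exp ρ := by
      have : 1 / (2 * τ) ≤ ρ := by
        rw [div_le_iff₀ (by positivity)]
        linarith
      linarith [Real.add_one_le_exp ρ]
    refine (mul_le_mul_of_nonneg_right ha (Real.exp_pos _).le).trans ?_
    rw [← Real.exp_add, Real.exp_le_exp]
    have hb : 0 ≤ 1 / 2 - 3 * (1 / g ^ 4) - 16 * τ := by rw [hτ]; linarith
    have hc := mul_le_mul_of_nonneg_right hR hb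
    have hd : ρ ^ 2 * (1 / g ^ 4) ≤ ρ ^ 2 * (1 / g) := by gcongr
    have he : ρ ^ 2 * τ = 500 * ρ + ρ ^ 2 * (1 / g) := by rw [hτ]; field_simp
    have hf : 3 * R / g ^ 4 = 3 * (R * (1 / g ^ 4)) := by ring
    have hh : 19 * ρ ^ 2 / g = 19 * (ρ ^ 2 * (1 / g)) := by ring
    rw [hf, hh]
    linarith
  linarith

end GaussMix

theorem theorem4p2 :
    ∃ C C' : ℝ, 0 < C ∧ 0 < C' ∧ ∃ ε : ℕ → ℝ, Tendsto ε atTop (𝓝 0) ∧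
      ∀ (n p : ℕ) (σ Δ : ℝ), 1 ≤ n → 1 ≤ p → 0 < σ → 0 < Δ →
        C < GaussMix.snr n p σ Δ →
        ∀ η₀ : Matrix (Fin p) (Fin n) ℝ → Fin n → ℝ, GaussMix.IsSpectralEstimator η₀ →
          (n : ℝ≥0∞)⁻¹ *
              GaussMix.worstCaseRisk σ Δ (GaussMix.lloyd η₀ ⌊3 * Real.log n⌋₊) ≤
            ENNReal.ofReal (C' * GaussMix.gaussTail
              (GaussMix.snr n p σ Δ *
                (1 - ε n - C' * Real.log (GaussMix.snr n p σ Δ) / GaussMix.snr n p σ Δ))) := by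
  refine ⟨3, 40000, by norm_num, by norm_num, fun n => 1000 / Real.sqrt (Real.sqrt n), ?_, ?_⟩
  · exact (((Real.tendsto_sqrt_atTop.comp Real.tendsto_sqrt_atTop).comp
      tendsto_natCast_atTop_atTop).const_div_atTop 1000)
  intro n p σ Δ hn _ hσ hΔ hC η₀ h₀
  set ρ := GaussMix.snr n p σ Δ with hρ
  set g := Real.sqrt (Real.sqrt n) with hg
  have hρ0 : 0 < ρ := by linarith
  have hn0 : (0 : ℝ) < n := by exact_mod_cast hn
  have hg0 : 0 < g := by rw [hg]; positivity
  have hg4 : g ^ 4 = n := by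
    have : g ^ 4 = (g ^ 2) ^ 2 := by ring
    rw [this, hg, Real.sq_sqrt (Real.sqrt_nonneg _), Real.sq_sqrt hn0.le]
  have hlog : 1 ≤ Real.log ρ := by
    rw [Real.le_log_iff_exp_le hρ0]
    linarith [Real.exp_one_lt_d9]
  have ht : ρ * (1 - 1000 / g - 40000 * Real.log ρ / ρ) =
      ρ - 1000 * (ρ / g) - 40000 * Real.log ρ := by
    field_simp
  rw [ht]
  set t := ρ - 1000 * (ρ / g) - 40000 * Real.log ρ with htdef
  apply GaussMix.worstCaseRisk_le_of_forall hn
  intro θ hθ η hη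
  rcases le_or_gt t 0 with ht0 | ht0
  · -- The bound is trivial here, as the loss is at most `n`.
    have h1 : 1 / 40000 ≤ GaussMix.gaussTail t := by
      refine le_trans ?_ ((GaussMix.gaussTail_ge le_rfl).trans (GaussMix.gaussTail_anti ht0))
      have := Real.add_one_le_exp (-(0 + 1) ^ 2 / 2 : ℝ)
      linarith
    have h2 : (1 : ℝ≥0∞) ≤ ENNReal.ofReal (40000 * GaussMix.gaussTail t) := by
      rw [ENNReal.one_le_ofReal]; linarith
    have : IsProbabilityMeasure (GaussMix.law σ θ η) :=
      Measure.isProbabilityMeasure_map (GaussMix.measurable_observation σ θ η).aemeasurable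
    calc _ ≤ ∫⁻ _, (n : ℝ≥0∞) ∂(GaussMix.law σ θ η) := by
          refine lintegral_mono fun Y => ?_
          rw [← ENNReal.ofReal_natCast]
          exact ENNReal.ofReal_le_ofReal
            (GaussMix.loss_le_card (GaussMix.isLabel_lloyd h₀ _ _) hη)
      _ = n * 1 := by rw [lintegral_const, measure_univ]
      _ ≤ _ := mul_le_mul_right h2 _
  · have hρ' : 40000 ≤ ρ := by
      have : 0 < 1000 * (ρ / g) := by positivity
      linarith
    have hg' : 1000 ≤ g := by
      have h1 : 1000 * (ρ / g) ≤ ρ := by linarith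
      have h2 : 1000 * (ρ / g) = 1000 / g * ρ := by ring
      rw [h2] at h1
      have h3 : 1000 / g ≤ 1 := by
        by_contra hcon
        nlinarith [not_le.1 hcon]
      rwa [div_le_one hg0] at h3
    have hθ0 : 0 < ‖θ‖ := hΔ.trans_le hθ
    have hR : ρ ^ 2 ≤ GaussMix.snrSq n p (‖θ‖ / σ) := by
      rw [hρ, GaussMix.snr_sq hσ hΔ]
      exact GaussMix.snrSq_mono (by positivity) (by gcongr)
    set τ := 500 / ρ + 1 / g with hτ
    have hτ0 : 0 < τ := by positivity
    have hτ1 : τ ≤ 1 / 16 := by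
      have h1 : 1 / g ≤ 1 / 1000 := one_div_le_one_div_of_le (by norm_num) hg'
      have h2 : 500 / ρ ≤ 1 / 80 := by
        rw [div_le_div_iff₀ hρ0 (by norm_num)]; linarith
      linarith
    have hg3 : 2 * g ≤ (n : ℝ) := by
      rw [← hg4]
      have : (1000 : ℝ) ^ 3 ≤ g ^ 3 := by gcongr
      nlinarith
    have hτn : 2 ≤ τ * n := by
      have h1 : 1 / g * (2 * g) = 2 := by field_simp
      have h2 : 1 / g ≤ τ := by
        have : 0 < 500 / ρ := by positivity
        linarith
      rw [← h1]
      exact mul_le_mul h2 hg3 (by positivity) hτ0.le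
    have hn2 : 2 ≤ n := by
      have : (2 : ℝ) ≤ n := by linarith
      exact_mod_cast this
    refine (GaussMix.lintegral_loss_le hn2 hσ θ hθ0 hη hτ0 hτ1 hτn h₀).trans ?_
    refine mul_le_mul_right (ENNReal.ofReal_le_ofReal ?_) _
    have h1 := GaussMix.risk_exponents_le hρ' hR hg' hτ
    rw [hg4] at h1
    refine h1.trans ?_
    have h2 := GaussMix.gaussTail_ge ht0.le
    have h3 : Real.exp (-ρ ^ 2 / 2 + 19 * ρ ^ 2 / g + 8001 * ρ) ≤
        Real.exp (-(t + 1) ^ 2 / 2) := by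
      rw [Real.exp_le_exp]
      -- `t + 1 ≤ ρ - x` with `0 ≤ x ≤ ρ`, whence `(t + 1)² ≤ ρ² - ρ x`.
      set x := 1000 * (ρ / g) + 39999 with hx
      have hx0 : 0 ≤ x := by positivity
      have htx : t + 1 ≤ ρ - x := by linarith
      have hsq : (t + 1) ^ 2 ≤ (ρ - x) ^ 2 := pow_le_pow_left₀ (by linarith) htx 2
      have hxρ : x ≤ ρ := by linarith
      have h4 : (ρ - x) ^ 2 ≤ ρ ^ 2 - ρ * x := by nlinarith
      have h5 : ρ * x = 1000 * (ρ ^ 2 / g) + 39999 * ρ := by rw [hx]; ring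
      have h6 : 19 * ρ ^ 2 / g = 19 * (ρ ^ 2 / g) := by ring
      have h7 : 0 ≤ ρ ^ 2 / g := by positivity
      rw [h6]
      linarith
    have h8 := Real.exp_pos (-(t + 1) ^ 2 / 2)
    linarith
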